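/- All graphs are finite and simple, $\log$ is the natural logarithm, and asymptotics are for $n\to\infty$. For a connected graph $G$, a vertex $v$ and $q\in(0,1]$, consider the following processes, in which initially exactly $v$ is informed. In each round every vertex $u$ chooses one of its neighbours $X_u$ uniformly at random and makes a call to it, which succeeds with probability $q$; all choices and all successes, over all vertices and all rounds, are independent. In \emph{push}, if $u$ was informed before the round and its call succeeds, then $X_u$ is informed after the round. In \emph{push\&pull}, if at least one of $u$ and $X_u$ was informed before the round and the call succeeds, then both are informed after the round. Informed vertices stay informed. Let $T_{push}(G,v,q)$ and $T_{pp}(G,v,q)\in\mathbb N_0\cup\{\infty\}$ be the number of rounds until all vertices are informed. Put $$c_{push}(q)=\frac1{\log(1+q)}+\frac1q\quad(0<q\le 1),\qquad c_{pp}(q)=\frac1{\log(1+2q)}+\frac1{q-\log(1-q)}\quad(0<q<1),$$ and $c_{pp}(1)=\lim_{q\uparrow1}c_{pp}(q)=1/\log 3$. A sequence $(G_n)_{n\ge1}$ of connected graphs, where $G_n$ has $n$ vertices, minimum degree $\delta_n$, maximum degree $\Delta_n$, and adjacency eigenvalues $\mu_1\ge\dots\ge\mu_n$ with $\lambda_n=\max_{2\le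 i\le n}|\mu_i|$, is an \emph{expander sequence} if $\Delta_n/\delta_n=1+o(1)$ and $\lambda_n=o(\Delta_n)$. \textbf{Theorem.} Let $\varepsilon>0$ and $q\in(0,1]$. Then there are an expander sequence $(G_n)_{n\ge1}$ and a sequence $(\tilde G_n)_{n\ge1}$ of connected graphs such that each $\tilde G_n$ is obtained from $G_n$ by deleting edges in such a way that every vertex keeps at least a $(1-\varepsilon)$ fraction of its edges, and such that the following holds. There are positive functions $g,h$ on the positive integers with $g(n)=o(\log n)$ and $h(n)=o(\log n)$ such that, uniformly over the initially informed vertex $v$ of $\tilde G_n$, with probability tending to $1$ as $n\to\infty$, $$T_{push}(\tilde G_n,v,q)\ \ge\ c_{push}(q)\log n+\frac{\varepsilon}{2q}\log n-g(n),$$ and, likewise uniformly in $v$ and with probability tending to $1$, $$T_{pp}(\tilde G_n,v,q)\ \ge\ c_{pp}(q)\log n+\Big(\frac{\varepsilon}{8q}-\frac{\varepsilon q^3}{5}\Big)\log n-h(n).$$ -/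

import Mathlib

open Filter Topology MeasureTheory ProbabilityTheory Asymptotics

namespace RumourSpreading

noncomputable section

/-! ### Expander sequences -/

open Classical in
/-- The adjacency matrix of a finite graph is Hermitian. -/
theorem isHermitian_adjMatrix {V : Type*} [Fintype V] (G : SimpleGraph V) :
    (G.adjMatrix ℝ).IsHermitian := by
  have h := G.isSymm_adjMatrix (α := ℝ)
  rw [Matrix.IsHermitian, Matrix.conjTranspose_eq_transpose_of_trivial]
  exact h

open Classical in
/-- `λ = max_{2 ≤ i ≤ n} |μᵢ|`, where `μ₁ ≥ μ₂ ≥ ⋯ ≥ μₙ` are the eigenvalues of the adjacency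
matrix (with index shifted by one: `eigenvalues₀` is the decreasing enumeration from index `0`).
For a graph with at most one vertex this is `0`. -/
def secondEigenvalue {V : Type*} [Fintype V] (G : SimpleGraph V) : ℝ :=
  ⨆ i : {i : Fin (Fintype.card V) // 0 < i.val}, |(isHermitian_adjMatrix G).eigenvalues₀ i|

open Classical in
/-- A sequence of connected graphs `G n` on `n` vertices (`n ≥ 1`) with minimum degree `δₙ`,
maximum degree `Δₙ` and second eigenvalue `λₙ` such that `Δₙ / δₙ = 1 + o(1)` and `λₙ = o(Δₙ)`. -/
structure IsExpanderSequence (G : (n : ℕ) → SimpleGraph (Fin n)) : Prop where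
  connected : ∀ n, 1 ≤ n → (G n).Connected
  degree_ratio : Tendsto (fun n => ((G n).maxDegree : ℝ) / ((G n).minDegree : ℝ)) atTop (𝓝 1)
  eigenvalue : (fun n => secondEigenvalue (G n)) =o[atTop] (fun n => ((G n).maxDegree : ℝ))

open Classical in
/-- `H` is obtained from `G` by deleting edges such that each vertex keeps at least a fraction `c`
of its edges. -/
def IsDeletionKeeping {V : Type*} [Fintype V] (c : ℝ) (G H : SimpleGraph V) : Prop :=
  H ≤ G ∧ ∀ v, c * (G.degree v : ℝ) ≤ (H.degree v : ℝ)

/-! ### The protocols -/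

/-- The two protocols. -/
inductive Protocol
  | push
  | pushPull

open Classical in
/-- The law of the neighbour that `v` calls in a round: uniform on the neighbours of `v`.
(A vertex without neighbours calls itself, which has no effect.) -/
def calleeLaw {V : Type*} [Fintype V] [MeasurableSpace V] (G : SimpleGraph V) (v : V) :
    Measure V :=
  if h : (G.neighborFinset v).Nonempty then (PMF.uniformOfFinset (G.neighborFinset v) h).toMeasure
  else Measure.dirac v

instance isProbabilityMeasure_calleeLaw {V : Type*} [Fintype V] [MeasurableSpace V]
    (G : SimpleGraph V) (v : V) :
    IsProbabilityMeasure (calleeLaw G v) := by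
  unfold calleeLaw
  split_ifs <;> infer_instance

/-- The law of one call by `v`: a neighbour chosen uniformly at random, and, independently, whether
the transmission along this call succeeds, which has probability `q`. -/
def callLaw {V : Type*} [Fintype V] [MeasurableSpace V] (G : SimpleGraph V) (q : unitInterval)
    (v : V) : Measure (V × Bool) :=
  (calleeLaw G v).prod (bernoulliMeasure true false q)

instance isProbabilityMeasure_callLaw {V : Type*} [Fintype V] [MeasurableSpace V]
    (G : SimpleGraph V) (q : unitInterval) (v : V) : IsProbabilityMeasure (callLaw G q v) := by
  unfold callLaw
  infer_instance

/-- The law of all calls: the calls are independent over all rounds `t` and all vertices `v`. -/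
def callsLaw {V : Type*} [Fintype V] [MeasurableSpace V] (G : SimpleGraph V) (q : unitInterval) :
    Measure (ℕ × V → V × Bool) :=
  Measure.infinitePi (fun p : ℕ × V => callLaw G q p.2)

/-- The set of informed vertices after one round, given the set `I` of informed vertices before it
and the call of each vertex. In push, the successful calls of informed vertices inform the called
vertices. In push&pull, moreover, each vertex with a successful call to an informed vertex becomes
informed. (In push the calls of uninformed vertices are simply ignored.) -/
def step {V : Type*} : Protocol → Set V → (V → V × Bool) → Set V
  | .push, I, calls => I ∪ {u | ∃ v ∈ I, calls v = (u, true)}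
  | .pushPull, I, calls =>
      I ∪ {u | ∃ v ∈ I, calls v = (u, true)} ∪ {u | ∃ v ∈ I, calls u = (v, true)}

/-- The set of vertices informed after `t` rounds when initially exactly `v` is informed. -/
def informed {V : Type*} (P : Protocol) (v : V) (ω : ℕ × V → V × Bool) : ℕ → Set V
  | 0 => {v}
  | t + 1 => step P (informed P v ω t) (fun u => ω (t, u))

/-- The runtime: the least number of rounds after which all vertices are informed, and `⊤` if this
never happens. -/
def runtime {V : Type*} (P : Protocol) (v : V) (ω : ℕ × V → V × Bool) : EReal :=
  ⨅ (t : ℕ) (_ : informed P v ω t = Set.univ), (t : EReal)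

/-- With high probability, the runtime of the protocol `P` on `G n` with transmission success
probability `q` is at least `c * log n - o(log n)`, irrespective of the initially informed
vertex. -/
def WhpRuntimeAtLeast (P : Protocol) (G : (n : ℕ) → SimpleGraph (Fin n)) (q : unitInterval)
    (c : ℝ) : Prop :=
  ∃ h : ℕ → ℝ, (∀ n, 0 < h n) ∧ h =o[atTop] (fun n => Real.log n) ∧
    Tendsto (fun n => ⨅ v : Fin n,
      callsLaw (G n) q {ω | ((c * Real.log n - h n : ℝ) : EReal) ≤ runtime P v ω})
      atTop (𝓝 1)

/-! ### The runtime constants of the complete graph -/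

/-- `c_push(q)`. -/
def cPush (q : ℝ) : ℝ := 1 / Real.log (1 + q) + 1 / q

/-- `c_pp(q)`; at `q = 1` it is the limit of the formula for `q < 1`, see `tendsto_cPP`. -/
def cPP (q : ℝ) : ℝ :=
  if q = 1 then 1 / Real.log 3
  else 1 / Real.log (1 + 2 * q) + 1 / (q - Real.log (1 - q))

theorem tendsto_cPP : Tendsto cPP (𝓝[<] 1) (𝓝 (cPP 1)) := by
  have h1 : Tendsto (fun q : ℝ => 1 / Real.log (1 + 2 * q)) (𝓝[<] 1) (𝓝 (1 / Real.log 3)) := by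
    have : ContinuousAt (fun q : ℝ => 1 / Real.log (1 + 2 * q)) 1 := by
      have h3 : Real.log (1 + 2 * 1) ≠ 0 := (Real.log_pos (by norm_num)).ne'
      have h4 : (1 + 2 * 1 : ℝ) ≠ 0 := by norm_num
      fun_prop (disch := assumption)
    have h2 := this.tendsto.mono_left (nhdsWithin_le_nhds (s := Set.Iio 1))
    norm_num at h2 ⊢
    exact h2
  have h2 : Tendsto (fun q : ℝ => 1 - q) (𝓝[<] 1) (𝓝[>] 0) := by
    refine tendsto_nhdsWithin_iff.2 ⟨?_, ?_⟩
    · have : Tendsto (fun q : ℝ => 1 - q) (𝓝 1) (𝓝 (1 - 1)) := by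
        exact (continuous_const.sub continuous_id).tendsto 1
      rw [sub_self] at this
      exact this.mono_left nhdsWithin_le_nhds
    · filter_upwards [self_mem_nhdsWithin] with q hq
      simpa using hq
  have h3 : Tendsto (fun q : ℝ => q - Real.log (1 - q)) (𝓝[<] 1) atTop := by
    have h4 := tendsto_neg_atBot_atTop.comp (Real.tendsto_log_nhdsGT_zero.comp h2)
    have h5 : Tendsto (fun q : ℝ => q) (𝓝[<] 1) (𝓝 1) := nhdsWithin_le_nhds
    simpa [sub_eq_add_neg, Function.comp_def] using h5.add_atTop h4
  have h6 := h1.add (tendsto_inv_atTop_zero.comp h3)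
  rw [add_zero] at h6
  rw [show cPP 1 = 1 / Real.log 3 by simp [cPP]]
  refine h6.congr' ?_
  filter_upwards [self_mem_nhdsWithin] with q hq
  have hq' : q ≠ 1 := ne_of_lt (Set.mem_Iio.1 hq)
  simp [cPP, hq']

end

end RumourSpreading

open RumourSpreading

namespace RumourSpreading

/-! For `ε < 1` the expander sequence consists of the complete graphs. Let A be a set of a vertices
inside a set D of d vertices, where d is about εn and a is about εn / log n, and delete all edges
between A and D, including those inside A. A vertex of A is now called only by the n - d vertices
outside D, each of degree n - 1, so it is left alone by the others in one round with probability
about exp(-q(1 - ε)) instead of exp(-q). As a = o(n), the initial growth is as in the complete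
graph: the expected number of informed vertices is multiplied per round by at most 1 + q in push and
1 + 2q + o(1) in push&pull (`sum_measureReal_mem_informed_le`, `tendsto_pull_rate`).

Split time into two phases of lengths α log n and β log n, with α and β slightly below the
reciprocals of the logarithmic growth rate and of the exponential rate at which a vertex of A ceases
to be avoided. After the first phase the expected number of informed vertices is at most n^θ with θ
< 1, whereas A has n^(1-o(1)) vertices. Call a vertex of A avoided if no call of the second phase
could inform it, whoever is informed; this event is independent of the first phase. Distinct
vertices of A are avoided with nonpositive correlation, because one call reaches only one vertex and
A is independent. A second moment argument (`measureReal_forall_imp_le`, applied in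
`measureReal_informed_eq_univ_le`) then produces an avoided vertex that was uninformed after the
first phase, and it remains uninformed.

This yields every constant below 1 / log(1 + q + pull part) + 1 / (q(1 - ε) - log(own)), where own
is 1 for push and 1 - q for push&pull (`whpRuntimeAtLeast_slowGraph_of_lt`). By convexity of the
reciprocal this sum strictly exceeds the claimed constants (`push_constant_lt`,
`pushPull_constant_lt`). For push&pull with q = 1 the ε-term is negative and the first phase alone
suffices. For `ε ≥ 1` any edge may be deleted, and a path needs linearly many rounds. -/

/-! ### Events determined by finitely many coordinates of a product space -/

section Coordinates

variable {ι X : Type*}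

/-- The event `E` is determined by the coordinates in `S`. -/
def DeterminedBy (S : Finset ι) (E : Set (ι → X)) : Prop :=
  ∀ ⦃ω ω' : ι → X⦄, (∀ i ∈ S, ω i = ω' i) → ω ∈ E → ω' ∈ E

/-- Pulls the event back from the finite space `S → X`, on which every set is measurable.
Measurability and independence of such events are then read off from the restriction map. -/
theorem DeterminedBy.eq_preimage {S : Finset ι} {E : Set (ι → X)} (h : DeterminedBy S E) :
    E = S.restrict ⁻¹' (S.restrict '' E) := by
  refine Set.Subset.antisymm (Set.subset_preimage_image _ _) ?_
  rintro ω ⟨ω', h', hω⟩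
  exact h (fun i hi => congrFun hω ⟨i, hi⟩) h'

theorem determinedBy_pi {S : Finset ι} (B : ι → Set X) :
    DeterminedBy S ((S : Set ι).pi B) := fun ω ω' h hω i hi => by
  rw [← h i hi]; exact hω i hi

variable [MeasurableSpace X] [Finite X] [MeasurableSingletonClass X]

theorem DeterminedBy.measurableSet {S : Finset ι} {E : Set (ι → X)} (h : DeterminedBy S E) :
    MeasurableSet E := by
  rw [h.eq_preimage]
  exact (Finset.measurable_restrict S) (Set.toFinite _).measurableSet

theorem DeterminedBy.measureReal_inter {S T : Finset ι} {E F : Set (ι → X)}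
    (hE : DeterminedBy S E) (hF : DeterminedBy T F) (hST : Disjoint S T)
    (ν : ι → Measure X) [∀ i, IsProbabilityMeasure (ν i)] :
    (Measure.infinitePi ν).real (E ∩ F) =
      (Measure.infinitePi ν).real E * (Measure.infinitePi ν).real F := by
  have h := (iIndepFun_infinitePi (P := ν) (X := fun _ x => x)
    (fun i => measurable_id)).indepFun_finset S T hST (fun i => measurable_pi_apply i)
  have h' := h.measure_inter_preimage_eq_mul (S.restrict '' E) (T.restrict '' F)
    (Set.toFinite _).measurableSet (Set.toFinite _).measurableSet
  change (Measure.infinitePi ν) (S.restrict ⁻¹' (S.restrict '' E) ∩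
    T.restrict ⁻¹' (T.restrict '' F)) = (Measure.infinitePi ν) (S.restrict ⁻¹' (S.restrict '' E)) *
      (Measure.infinitePi ν) (T.restrict ⁻¹' (T.restrict '' F)) at h'
  rw [← hE.eq_preimage, ← hF.eq_preimage] at h'
  simp only [measureReal_def, h', ENNReal.toReal_mul]

end Coordinates

/-! ### A second moment bound -/

/-- If the events `E i`, `i ∈ A`, have probability `p` and are pairwise nonpositively correlated,
and on average few of them occur together with `F i`, then it is unlikely that every occurring
`E i` is accompanied by `F i`. -/
theorem measureReal_forall_imp_le {Ω κ : Type*} [MeasurableSpace Ω] (μ : Measure Ω)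
    [IsProbabilityMeasure μ] (A : Finset κ) (hA : A.Nonempty) (E F : κ → Set Ω)
    (hE : ∀ i ∈ A, MeasurableSet (E i)) (hF : ∀ i ∈ A, MeasurableSet (F i)) {p g : ℝ} (hp : 0 < p)
    (hEp : ∀ i ∈ A, μ.real (E i) = p)
    (hpair : ∀ i ∈ A, ∀ j ∈ A, i ≠ j → μ.real (E i ∩ E j) ≤ p ^ 2)
    (hFg : ∑ i ∈ A, μ.real (E i ∩ F i) ≤ g * p) :
    μ.real {ω | ∀ i ∈ A, ω ∈ E i → ω ∈ F i} ≤ 4 / (A.card * p) + 2 * g / A.card := by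
  classical
  set m : ℝ := A.card * p with hm
  have hc : (0 : ℝ) < A.card := by exact_mod_cast hA.card_pos
  have hm0 : 0 < m := by positivity
  set bad : Set Ω := {ω | ∀ i ∈ A, ω ∈ E i → ω ∈ F i}
  have hbad : MeasurableSet bad := by
    have : bad = ⋂ i ∈ A, ((E i)ᶜ ∪ F i) := by
      ext ω; simp [bad, imp_iff_not_or]
    rw [this]
    exact Finset.measurableSet_biInter _ fun i hi => (hE i hi).compl.union (hF i hi)
  have hindicator : ∀ s : Set Ω, MeasurableSet s → Integrable (s.indicator (1 : Ω → ℝ)) μ := fun s hs =>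
    (integrable_const (1 : ℝ)).indicator hs
  -- With x the number of occurring `E i` and y the number of occurring `E i ∩ F i`, this is 4(x -
  -- m)²/m² + 2y/m, expanded so that its integral is a sum of probabilities. On `bad` one has x = y,
  -- so either y ≥ m/2 and the Markov term is at least 1, or x ≤ m/2 and the Chebyshev term is.
  set f : Ω → ℝ := fun ω =>
    4 / m ^ 2 * ((∑ i ∈ A, ∑ j ∈ A, (E i ∩ E j).indicator 1 ω)
      - 2 * m * (∑ i ∈ A, (E i).indicator 1 ω) + m ^ 2)
      + 2 / m * ∑ i ∈ A, (E i ∩ F i).indicator 1 ω with hf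
  have hi1 : Integrable (fun ω => ∑ i ∈ A, ∑ j ∈ A, (E i ∩ E j).indicator (1 : Ω → ℝ) ω) μ :=
    integrable_finsetSum _ fun i hi => integrable_finsetSum _ fun j hj =>
      hindicator _ ((hE i hi).inter (hE j hj))
  have hi2 : Integrable (fun ω => ∑ i ∈ A, (E i).indicator (1 : Ω → ℝ) ω) μ :=
    integrable_finsetSum _ fun i hi => hindicator _ (hE i hi)
  have hi3 : Integrable (fun ω => ∑ i ∈ A, (E i ∩ F i).indicator (1 : Ω → ℝ) ω) μ :=
    integrable_finsetSum _ fun i hi => hindicator _ ((hE i hi).inter (hF i hi))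
  have hi4 : Integrable (fun ω => (∑ i ∈ A, ∑ j ∈ A, (E i ∩ E j).indicator (1 : Ω → ℝ) ω)
      - 2 * m * (∑ i ∈ A, (E i).indicator 1 ω)) μ := hi1.sub (hi2.const_mul _)
  have hi5 : Integrable (fun ω => (∑ i ∈ A, ∑ j ∈ A, (E i ∩ E j).indicator (1 : Ω → ℝ) ω)
      - 2 * m * (∑ i ∈ A, (E i).indicator 1 ω) + m ^ 2) μ := hi4.add (integrable_const _)
  have hfi : Integrable f μ := (hi5.const_mul _).add (hi3.const_mul _)
  have hle : ∀ ω, bad.indicator (1 : Ω → ℝ) ω ≤ f ω := by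
    intro ω
    set x : ℝ := ∑ i ∈ A, (E i).indicator 1 ω with hx
    set y : ℝ := ∑ i ∈ A, (E i ∩ F i).indicator 1 ω with hy
    have hsq : (∑ i ∈ A, ∑ j ∈ A, (E i ∩ E j).indicator (1 : Ω → ℝ) ω) = x ^ 2 := by
      rw [hx, sq, Finset.sum_mul_sum]
      refine Finset.sum_congr rfl fun i _ => Finset.sum_congr rfl fun j _ => ?_
      rw [Set.inter_indicator_one]; rfl
    have hfx : f ω = 4 / m ^ 2 * (x - m) ^ 2 + 2 / m * y := by
      simp only [hf, hsq, ← hx, ← hy]; ring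
    have hy0 : 0 ≤ y := Finset.sum_nonneg fun i _ => Set.indicator_nonneg (by simp) _
    rw [hfx]
    by_cases hω : ω ∈ bad
    · have hxy : x = y := by
        refine Finset.sum_congr rfl fun i hi => ?_
        by_cases h : ω ∈ E i
        · have := hω i hi h
          simp [h, this]
        · simp [h]
      rw [Set.indicator_of_mem hω, Pi.one_apply]
      rcases le_total (m / 2) y with h | h
      · have h1 : 1 ≤ 2 / m * y := by
          rw [div_mul_eq_mul_div, le_div_iff₀ hm0]; linarith
        have : 0 ≤ 4 / m ^ 2 * (x - m) ^ 2 := by positivity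
        linarith
      · have h1 : 1 ≤ 4 / m ^ 2 * (x - m) ^ 2 := by
          rw [div_mul_eq_mul_div, le_div_iff₀ (by positivity)]
          rw [← hxy] at h
          nlinarith
        have : 0 ≤ 2 / m * y := by positivity
        linarith
    · rw [Set.indicator_of_notMem hω]
      positivity
  have hI := integral_mono (hindicator _ hbad) hfi hle
  have hfint : ∫ ω, f ω ∂μ = 4 / m ^ 2 * ((∑ i ∈ A, ∑ j ∈ A, μ.real (E i ∩ E j))
      - 2 * m * (∑ i ∈ A, μ.real (E i)) + m ^ 2) + 2 / m * ∑ i ∈ A, μ.real (E i ∩ F i) := by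
    simp only [hf]
    rw [integral_add (hi5.const_mul _) (hi3.const_mul _), integral_const_mul, integral_const_mul,
      integral_add hi4 (integrable_const _),
      integral_sub hi1 (hi2.const_mul _), integral_const_mul,
      integral_finsetSum _ fun i hi => integrable_finsetSum _ fun j hj =>
        hindicator _ ((hE i hi).inter (hE j hj)),
      integral_finsetSum _ fun i hi => hindicator _ (hE i hi),
      integral_finsetSum _ fun i hi => hindicator _ ((hE i hi).inter (hF i hi))]
    congr 1
    · congr 2
      · congr 1
        · refine Finset.sum_congr rfl fun i hi => ?_
          rw [integral_finsetSum _ fun j hj => hindicator _ ((hE i hi).inter (hE j hj))]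
          exact Finset.sum_congr rfl fun j hj => integral_indicator_one ((hE i hi).inter (hE j hj))
        · congr 1
          exact Finset.sum_congr rfl fun i hi => integral_indicator_one (hE i hi)
      · simp
    · congr 1
      exact Finset.sum_congr rfl fun i hi => integral_indicator_one ((hE i hi).inter (hF i hi))
  rw [integral_indicator_one hbad, hfint] at hI
  have hs1 : ∑ i ∈ A, μ.real (E i) = m := by
    rw [Finset.sum_congr rfl hEp, Finset.sum_const, nsmul_eq_mul]
  have hs2 : ∑ i ∈ A, ∑ j ∈ A, μ.real (E i ∩ E j) ≤ m + m ^ 2 := by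
    have : ∀ i ∈ A, ∀ j ∈ A, μ.real (E i ∩ E j) ≤ (if i = j then p else 0) + p ^ 2 := by
      intro i hi j hj
      split_ifs with h
      · subst h
        rw [Set.inter_self, hEp i hi]
        have := sq_nonneg p; linarith
      · rw [zero_add]; exact hpair i hi j hj h
    calc _ ≤ ∑ i ∈ A, ∑ j ∈ A, ((if i = j then p else 0) + p ^ 2) :=
          Finset.sum_le_sum fun i hi => Finset.sum_le_sum fun j hj => this i hi j hj
      _ = m + m ^ 2 := by
          simp only [Finset.sum_add_distrib, Finset.sum_ite_eq, Finset.sum_const, nsmul_eq_mul]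
          rw [Finset.sum_congr rfl fun i hi => if_pos hi]
          simp only [Finset.sum_const, nsmul_eq_mul, hm]; ring
  -- As x has mean m, the terms m² - 2m² + m² cancel; only the diagonal contribution 4/m and the
  -- Markov term remain.
  calc _ ≤ _ := hI
    _ ≤ 4 / m ^ 2 * (m + m ^ 2 - 2 * m * m + m ^ 2) + 2 / m * (g * p) := by
        rw [hs1]; gcongr
    _ = _ := by rw [hm]; field_simp; ring

/-! ### The law of one call -/

section Calls

variable {V : Type*} [Fintype V] [MeasurableSpace V] (G : SimpleGraph V) (q : unitInterval)

/-- The probability that `v` makes a successful call to `u`. -/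
noncomputable def callProb (v u : V) : ℝ := (callLaw G q v).real {(u, true)}

theorem callProb_nonneg (v u : V) : 0 ≤ callProb G q v u := measureReal_nonneg

theorem callProb_eq_mul (v u : V) : callProb G q v u = (calleeLaw G v).real {u} * q := by
  rw [callProb, callLaw, ← Set.singleton_prod_singleton, measureReal_prod_prod,
    bernoulliMeasure_real_apply_of_mem_of_notMem] <;> simp

theorem callLaw_real_snd_false (v : V) :
    (callLaw G q v).real {x | x.2 = false} = 1 - q := by
  have : {x : V × Bool | x.2 = false} = Set.univ ×ˢ {false} := by ext x; simp
  rw [this, callLaw, measureReal_prod_prod, bernoulliMeasure_real_apply_of_notMem_of_mem] <;> simp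

variable [MeasurableSingletonClass V]

open Classical in
theorem callProb_eq {v : V} (hv : 0 < G.degree v) (u : V) :
    callProb G q v u = if G.Adj v u then (q : ℝ) / G.degree v else 0 := by
  have h : (G.neighborFinset v).Nonempty := by
    rwa [← Finset.card_pos, SimpleGraph.card_neighborFinset_eq_degree]
  rw [callProb_eq_mul, calleeLaw, dif_pos h, measureReal_def,
    PMF.toMeasure_apply_singleton _ _ (measurableSet_singleton u), PMF.uniformOfFinset_apply]
  simp only [SimpleGraph.mem_neighborFinset, SimpleGraph.card_neighborFinset_eq_degree]
  split_ifs
  · simp [div_eq_inv_mul]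
  · simp

/-- Valid also for isolated vertices, since these call themselves. -/
theorem sum_callProb (v : V) : ∑ u, callProb G q v u = q := by
  simp only [callProb_eq_mul, ← Finset.sum_mul]
  rw [sum_measureReal_singleton]
  simp

theorem ae_callLaw_adj (v : V) : ∀ᵐ x ∂callLaw G q v, x.1 = v ∨ G.Adj v x.1 := by
  classical
  have h : ∀ᵐ x ∂calleeLaw G v, x = v ∨ G.Adj v x := by
    unfold calleeLaw
    split_ifs with h
    · rw [ae_iff, PMF.toMeasure_apply_eq_zero_iff _ (Set.toFinite _).measurableSet,
        PMF.support_uniformOfFinset, Set.disjoint_left]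
      intro x hx hx'
      simp only [Finset.mem_coe, SimpleGraph.mem_neighborFinset] at hx
      exact hx' (Or.inr hx)
    · rw [ae_dirac_iff (Set.toFinite _).measurableSet]
      exact Or.inl rfl
  exact Measure.quasiMeasurePreserving_fst.ae h

end Calls

/-! ### The spreading process -/

/-- The factor with which pulls enter the growth of the set of informed vertices. -/
def pullFactor : Protocol → ℝ
  | .push => 0
  | .pushPull => 1

/-- The probability that the call of a vertex does not inform the vertex itself,
irrespective of the informed vertices. -/
def ownCallHarmless : Protocol → ℝ → ℝ
  | .push, _ => 1
  | .pushPull, q => 1 - q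

theorem mem_step_iff {V : Type*} {P : Protocol} {I : Set V} {calls : V → V × Bool} {u : V} :
    u ∈ step P I calls ↔ u ∈ I ∨ (∃ v ∈ I, calls v = (u, true)) ∨
      (P = .pushPull ∧ ∃ v ∈ I, calls u = (v, true)) := by
  cases P <;> simp [step, or_assoc]

theorem mem_informed_succ_iff {V : Type*} {P : Protocol} {v u : V} {ω : ℕ × V → V × Bool} {t : ℕ} :
    u ∈ informed P v ω (t + 1) ↔ u ∈ informed P v ω t ∨
      (∃ w ∈ informed P v ω t, ω (t, w) = (u, true)) ∨
      (P = .pushPull ∧ ∃ w ∈ informed P v ω t, ω (t, u) = (w, true)) :=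
  mem_step_iff

theorem informed_subset_succ {V : Type*} (P : Protocol) (v : V) (ω : ℕ × V → V × Bool) (t : ℕ) :
    informed P v ω t ⊆ informed P v ω (t + 1) := fun _ h => mem_step_iff.2 (Or.inl h)

theorem informed_mono {V : Type*} (P : Protocol) (v : V) (ω : ℕ × V → V × Bool) :
    Monotone (informed P v ω) :=
  monotone_nat_of_le_succ fun t => informed_subset_succ P v ω t

/-- If some vertex is not informed after `t` rounds, then the runtime is at least `t`. -/
theorem le_runtime {V : Type*} {P : Protocol} {v : V} {ω : ℕ × V → V × Bool} {t : ℕ}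
    (h : informed P v ω t ≠ Set.univ) : ((t : ℝ) : EReal) ≤ runtime P v ω := by
  refine le_iInf₂ fun s hs => ?_
  have : t ≤ s := by
    by_contra! hst
    exact h (Set.eq_univ_of_univ_subset (hs ▸ informed_mono P v ω hst.le))
  exact_mod_cast this

section Spreading

theorem determinedBy_eval {V : Type*} (i : ℕ × V) (B : Set (V × Bool)) :
    DeterminedBy {i} {ω : ℕ × V → V × Bool | ω i ∈ B} := fun ω ω' h hω => by
  rw [Set.mem_ofPred_eq] at hω ⊢
  rwa [← h i (Finset.mem_singleton_self i)]

variable {V : Type*} [Fintype V]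

theorem informed_congr (P : Protocol) (v : V) {ω ω' : ℕ × V → V × Bool} (t : ℕ)
    (h : ∀ i ∈ Finset.range t ×ˢ (Finset.univ : Finset V), ω i = ω' i) :
    informed P v ω t = informed P v ω' t := by
  induction t with
  | zero => rfl
  | succ t ih =>
    have h1 := ih fun i hi => h i (by
      simp only [Finset.mem_product, Finset.mem_range, Finset.mem_univ, and_true] at hi ⊢; omega)
    have h2 : (fun u => ω (t, u)) = fun u => ω' (t, u) := funext fun u => h (t, u) (by simp)
    simp only [informed, h1, h2]

theorem determinedBy_mem_informed (P : Protocol) (v u : V) (t : ℕ) :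
    DeterminedBy (Finset.range t ×ˢ (Finset.univ : Finset V)) {ω | u ∈ informed P v ω t} :=
  fun ω ω' h hω => by
    rw [Set.mem_ofPred_eq] at hω ⊢
    rwa [← informed_congr P v t h]

variable [MeasurableSpace V] [MeasurableSingletonClass V] (G : SimpleGraph V) (q : unitInterval)

instance isProbabilityMeasure_callsLaw : IsProbabilityMeasure (callsLaw G q) := by
  unfold callsLaw; infer_instance

theorem callsLaw_real_eval (i : ℕ × V) (B : Set (V × Bool)) :
    (callsLaw G q).real {ω | ω i ∈ B} = (callLaw G q i.2).real B := by
  have h := measurePreserving_eval_infinitePi (fun p : ℕ × V => callLaw G q p.2) i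
  exact h.measureReal_preimage (Set.toFinite B).measurableSet.nullMeasurableSet

/-- The informed set after `t` rounds depends only on the rounds before round `t`, so it is
independent of the calls of round `t`. -/
theorem callsLaw_real_informed_and_call (P : Protocol) (v w x u : V) (t : ℕ) :
    (callsLaw G q).real ({ω | w ∈ informed P v ω t} ∩ {ω | ω (t, x) ∈ ({(u, true)} : Set _)}) =
      (callsLaw G q).real {ω | w ∈ informed P v ω t} * callProb G q x u := by
  rw [callsLaw, (determinedBy_mem_informed P v w t).measureReal_inter (determinedBy_eval (t, x) _)
    (by simp), ← callsLaw, callsLaw_real_eval]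
  rfl

/-- The expected number of informed vertices grows by a factor of at most `γ` per round. -/
theorem sum_measureReal_mem_informed_le (P : Protocol) {γ : ℝ}
    (hγ : ∀ v, 1 + q + pullFactor P * ∑ u, callProb G q u v ≤ γ) (v : V) (t : ℕ) :
    ∑ u, (callsLaw G q).real {ω | u ∈ informed P v ω t} ≤ γ ^ t := by
  classical
  have hγ0 : 0 ≤ γ := by
    refine le_trans ?_ (hγ v)
    have h1 : 0 ≤ (q : ℝ) := q.2.1
    have h2 : 0 ≤ ∑ u, callProb G q u v := Finset.sum_nonneg fun u _ => callProb_nonneg G q u v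
    have h3 : 0 ≤ pullFactor P := by cases P <;> simp [pullFactor]
    positivity
  induction t with
  | zero =>
    have : ∀ u, (callsLaw G q).real {ω | u ∈ informed P v ω 0} = if u = v then 1 else 0 := by
      intro u
      split_ifs with h <;> simp [informed, h]
    simp [this]
  | succ t ih =>
    set m : V → ℝ := fun u => (callsLaw G q).real {ω | u ∈ informed P v ω t} with hm
    have hstep : ∀ u, (callsLaw G q).real {ω | u ∈ informed P v ω (t + 1)} ≤
        m u + ∑ w, m w * callProb G q w u + pullFactor P * ∑ w, m w * callProb G q u w := by
      intro u
      set C : V → Set (ℕ × V → V × Bool) := fun w =>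
        {ω | w ∈ informed P v ω t} ∩ {ω | ω (t, w) ∈ ({(u, true)} : Set _)}
      set D : V → Set (ℕ × V → V × Bool) := fun w =>
        {ω | w ∈ informed P v ω t} ∩ {ω | ω (t, u) ∈ ({(w, true)} : Set _)}
      have hC : (callsLaw G q).real (⋃ w, C w) ≤ ∑ w, m w * callProb G q w u :=
        (measureReal_iUnion_fintype_le _).trans_eq
          (Finset.sum_congr rfl fun w _ => callsLaw_real_informed_and_call G q P v w w u t)
      have hD : (callsLaw G q).real (⋃ w, D w) ≤ ∑ w, m w * callProb G q u w :=
        (measureReal_iUnion_fintype_le _).trans_eq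
          (Finset.sum_congr rfl fun w _ => callsLaw_real_informed_and_call G q P v w u w t)
      cases P with
      | push =>
        have hsub : {ω | u ∈ informed .push v ω (t + 1)} ⊆
            {ω | u ∈ informed .push v ω t} ∪ ⋃ w, C w := by
          intro ω hω
          rw [Set.mem_ofPred_eq] at hω
          rcases mem_informed_succ_iff.1 hω with h | ⟨w, hw, h⟩ | ⟨h, -⟩
          · exact Or.inl h
          · exact Or.inr (Set.mem_iUnion.2 ⟨w, hw, h⟩)
          · cases h
        have h1 := (measureReal_mono hsub (measure_ne_top (callsLaw G q) _)).trans
          (measureReal_union_le _ _)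
        simp only [pullFactor, zero_mul, add_zero]
        exact h1.trans (add_le_add le_rfl hC)
      | pushPull =>
        have hsub : {ω | u ∈ informed .pushPull v ω (t + 1)} ⊆
            ({ω | u ∈ informed .pushPull v ω t} ∪ ⋃ w, C w) ∪ ⋃ w, D w := by
          intro ω hω
          rw [Set.mem_ofPred_eq] at hω
          rcases mem_informed_succ_iff.1 hω with h | ⟨w, hw, h⟩ | ⟨-, w, hw, h⟩
          · exact Or.inl (Or.inl h)
          · exact Or.inl (Or.inr (Set.mem_iUnion.2 ⟨w, hw, h⟩))
          · exact Or.inr (Set.mem_iUnion.2 ⟨w, hw, h⟩)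
        have h1 := (measureReal_mono hsub (measure_ne_top (callsLaw G q) _)).trans
          ((measureReal_union_le _ _).trans (add_le_add_left (measureReal_union_le _ _) _))
        simp only [pullFactor, one_mul]
        exact h1.trans (add_le_add (add_le_add le_rfl hC) hD)
    calc _ ≤ ∑ u, (m u + ∑ w, m w * callProb G q w u
            + pullFactor P * ∑ w, m w * callProb G q u w) := Finset.sum_le_sum fun u _ => hstep u
      -- Exchanging the sums charges everything to the informed vertex `w`: it persists, its own
      -- call informs at most `q` vertices in expectation, and pulls inform at most the expected
      -- number of successful calls to `w`.
      _ = ∑ w, m w * (1 + q + pullFactor P * ∑ u, callProb G q u w) := by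
          rw [Finset.sum_add_distrib, Finset.sum_add_distrib, Finset.sum_comm, ← Finset.mul_sum,
            Finset.sum_comm (f := fun u w => m w * callProb G q u w), Finset.mul_sum,
            ← Finset.sum_add_distrib, ← Finset.sum_add_distrib]
          refine Finset.sum_congr rfl fun w _ => ?_
          rw [← Finset.mul_sum, ← Finset.mul_sum, sum_callProb]
          ring
      _ ≤ ∑ w, m w * γ := Finset.sum_le_sum fun w _ =>
          mul_le_mul_of_nonneg_left (hγ w) measureReal_nonneg
      _ = (∑ w, m w) * γ := by rw [Finset.sum_mul]
      _ ≤ γ ^ t * γ := mul_le_mul_of_nonneg_right ih hγ0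
      _ = γ ^ (t + 1) := (pow_succ γ t).symm

end Spreading

/-! ### Vertices avoided by all calls -/

/-- The calls of `v` which cannot inform `u` if `u` is uninformed. -/
def avoid {V : Type*} (P : Protocol) (u v : V) : Set (V × Bool) :=
  {x | (v ≠ u → x ≠ (u, true)) ∧ (v = u → P = .pushPull → x.2 = false)}

/-- No call in the rounds `t₁ ≤ t < t₁ + t₂` can inform `u`. -/
def avoided {V : Type*} [Fintype V] (P : Protocol) (u : V) (t₁ t₂ : ℕ) :
    Set (ℕ × V → V × Bool) :=
  ((Finset.Ico t₁ (t₁ + t₂) ×ˢ (Finset.univ : Finset V) : Finset (ℕ × V)) : Set (ℕ × V)).pi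
    fun p => avoid P u p.2

section Avoid

variable {V : Type*} [Fintype V]

theorem notMem_informed_of_avoided {P : Protocol} {v u : V} {ω : ℕ × V → V × Bool} {t₁ t₂ : ℕ}
    (hu : u ∉ informed P v ω t₁) (hω : ω ∈ avoided P u t₁ t₂) :
    u ∉ informed P v ω (t₁ + t₂) := by
  have key : ∀ k ≤ t₂, u ∉ informed P v ω (t₁ + k) := by
    intro k
    induction k with
    | zero => exact fun _ => hu
    | succ k ih =>
      intro hk hmem
      rw [← add_assoc] at hmem
      have hnot := ih (by omega)
      have hav : ∀ w, ω (t₁ + k, w) ∈ avoid P u w := fun w => hω (t₁ + k, w) (by simp; omega)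
      rcases mem_informed_succ_iff.1 hmem with h | ⟨w, hw, h⟩ | ⟨hP, w, hw, h⟩
      · exact hnot h
      · exact (hav w).1 (fun h' => hnot (h' ▸ hw)) h
      · have := (hav u).2 rfl hP
        rw [h] at this
        cases this
  exact key t₂ le_rfl

variable [MeasurableSpace V] (G : SimpleGraph V) (q : unitInterval)

theorem callLaw_real_avoid_self (P : Protocol) (u : V) :
    (callLaw G q u).real (avoid P u u) = ownCallHarmless P q := by
  cases P with
  | push =>
    have : avoid .push u u = Set.univ := by ext x; simp [avoid]
    simp [this, ownCallHarmless]
  | pushPull =>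
    have : avoid .pushPull u u = {x | x.2 = false} := by ext x; simp [avoid]
    rw [this, callLaw_real_snd_false]
    rfl

variable [MeasurableSingletonClass V]

theorem callLaw_real_avoid_of_ne (P : Protocol) {u v : V} (h : v ≠ u) :
    (callLaw G q v).real (avoid P u v) = 1 - callProb G q v u := by
  have : avoid P u v = ({(u, true)} : Set (V × Bool))ᶜ := by ext x; simp [avoid, h]
  rw [this, probReal_compl_eq_one_sub (measurableSet_singleton _)]
  rfl

/-- A call reaches only one vertex, so reaching `u` and reaching `w` are disjoint events, and 1 - x
- y ≤ (1 - x)(1 - y). If the caller is `u` or `w`, it almost surely makes no successful call to the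
other one, and the corresponding factor is 1. -/
theorem callLaw_real_avoid_inter_le (P : Protocol) {u w : V} (huw : u ≠ w)
    (hu : callProb G q u w = 0) (hw : callProb G q w u = 0) (v : V) :
    (callLaw G q v).real (avoid P u v ∩ avoid P w v) ≤
      (callLaw G q v).real (avoid P u v) * (callLaw G q v).real (avoid P w v) := by
  by_cases h1 : v = u
  · subst h1
    rw [callLaw_real_avoid_of_ne G q P huw, hu, sub_zero, mul_one]
    exact measureReal_mono Set.inter_subset_left
  by_cases h2 : v = w
  · subst h2
    rw [callLaw_real_avoid_of_ne G q P h1, hw, sub_zero, one_mul]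
    exact measureReal_mono Set.inter_subset_right
  rw [callLaw_real_avoid_of_ne G q P h1, callLaw_real_avoid_of_ne G q P h2]
  have h3 : avoid P u v ∩ avoid P w v = ({(u, true)} ∪ {(w, true)} : Set (V × Bool))ᶜ := by
    ext x; simp [avoid, h1, h2, and_comm]
  rw [h3, probReal_compl_eq_one_sub (Set.toFinite _).measurableSet, measureReal_union
    (by simpa using huw) (measurableSet_singleton _)]
  have := mul_nonneg (callProb_nonneg G q v u) (callProb_nonneg G q v w)
  change 1 - (callProb G q v u + callProb G q v w) ≤ _
  linarith

theorem callsLaw_real_pi (t₁ t₂ : ℕ) (B : V → Set (V × Bool)) :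
    (callsLaw G q).real (((Finset.Ico t₁ (t₁ + t₂) ×ˢ (Finset.univ : Finset V) :
      Finset (ℕ × V)) : Set (ℕ × V)).pi fun p => B p.2) =
      (∏ v, (callLaw G q v).real (B v)) ^ t₂ := by
  rw [measureReal_def, callsLaw, Measure.infinitePi_pi _ fun i _ => (Set.toFinite _).measurableSet,
    ENNReal.toReal_prod, Finset.prod_product]
  simp [measureReal_def]

/-- A quantitative lower bound for the runtime: consider a set `A` of pairwise non-adjacent vertices
each of which, as long as it is uninformed, stays uninformed in a round with probability at least
`s`. -/
theorem measureReal_informed_eq_univ_le (P : Protocol) (A : Finset V) (hA : A.Nonempty)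
    (hind : ∀ u ∈ A, ∀ w ∈ A, callProb G q u w = 0) {s γ : ℝ}
    (hs : ∀ u ∈ A, ∏ v, (callLaw G q v).real (avoid P u v) = s)
    (hγ : ∀ v, 1 + q + pullFactor P * ∑ u, callProb G q u v ≤ γ) (v : V) (t₁ t₂ : ℕ)
    (hpos : 0 < s ^ t₂) :
    (callsLaw G q).real {ω | informed P v ω (t₁ + t₂) = Set.univ} ≤
      4 / (A.card * s ^ t₂) + 2 * γ ^ t₁ / A.card := by
  have hdet : ∀ u, DeterminedBy (Finset.Ico t₁ (t₁ + t₂) ×ˢ (Finset.univ : Finset V))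
      (avoided P u t₁ t₂) := fun u => determinedBy_pi _
  refine (measureReal_mono ?_).trans (measureReal_forall_imp_le (callsLaw G q) A hA
    (fun u => avoided P u t₁ t₂) (fun u => {ω | u ∈ informed P v ω t₁})
    (fun u _ => (hdet u).measurableSet)
    (fun u _ => (determinedBy_mem_informed P v u t₁).measurableSet) hpos ?_ ?_ ?_)
  -- If everything is informed at the end, each avoided vertex of `A` was informed already after
  -- `t₁` rounds.
  · intro ω hω u _ hav
    by_contra hu
    exact notMem_informed_of_avoided hu hav (hω ▸ Set.mem_univ u)
  · intro u hu
    rw [avoided, callsLaw_real_pi, hs u hu]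
  · intro u hu w hw huw
    have : avoided P u t₁ t₂ ∩ avoided P w t₁ t₂ =
        ((Finset.Ico t₁ (t₁ + t₂) ×ˢ (Finset.univ : Finset V) : Finset (ℕ × V)) : Set (ℕ × V)).pi
          fun p => avoid P u p.2 ∩ avoid P w p.2 := Set.pi_inter_distrib.symm
    rw [this, callsLaw_real_pi G q t₁ t₂ fun v => avoid P u v ∩ avoid P w v, ← pow_mul, mul_comm,
      pow_mul]
    refine pow_le_pow_left₀ (Finset.prod_nonneg fun v _ => measureReal_nonneg) ?_ _
    calc _ ≤ ∏ v, ((callLaw G q v).real (avoid P u v) * (callLaw G q v).real (avoid P w v)) :=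
          Finset.prod_le_prod (fun v _ => measureReal_nonneg) fun v _ =>
            callLaw_real_avoid_inter_le G q P huw (hind u hu w hw) (hind w hw u hu) v
      _ = s ^ 2 := by rw [Finset.prod_mul_distrib, hs u hu, hs w hw, sq]
  -- The two events live on disjoint sets of rounds, so the expected overlap factorises, and the
  -- growth bound gives at most γ^t₁ · s^t₂.
  · have hind' : ∀ u ∈ A, (callsLaw G q).real (avoided P u t₁ t₂ ∩ {ω | u ∈ informed P v ω t₁}) =
        (callsLaw G q).real {ω | u ∈ informed P v ω t₁} * s ^ t₂ := by
      intro u hu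
      rw [Set.inter_comm, callsLaw, (determinedBy_mem_informed P v u t₁).measureReal_inter (hdet u),
        ← callsLaw, avoided, callsLaw_real_pi, hs u hu]
      rw [Finset.disjoint_left]
      simp only [Finset.mem_product, Finset.mem_range, Finset.mem_Ico]
      omega
    rw [Finset.sum_congr rfl hind', ← Finset.sum_mul]
    refine mul_le_mul_of_nonneg_right ?_ hpos.le
    exact (Finset.sum_le_univ_sum_of_nonneg fun u => measureReal_nonneg).trans
      (sum_measureReal_mem_informed_le G q P hγ v t₁)

end Avoid

/-! ### Complete graphs form an expander sequence -/

/-- The matrix is J - I, so an eigenvector w with coordinate sum S satisfies S = (μ + 1) wᵢ for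
every i. If S = 0, some nonzero coordinate forces μ = -1; otherwise summing over i and cancelling S
gives μ + 1 = n. -/
theorem eigenvalue_complete {n : ℕ} {A : Matrix (Fin n) (Fin n) ℝ} (hA : A.IsHermitian)
    (hadj : ∀ i j, A i j = if i = j then 0 else 1) (k : Fin n) :
    hA.eigenvalues k = -1 ∨ hA.eigenvalues k = n - 1 := by
  set μ := hA.eigenvalues k with hμ
  set w : Fin n → ℝ := (hA.eigenvectorBasis k).ofLp with hw
  have hne : w ≠ 0 := by
    intro h
    apply hA.eigenvectorBasis.orthonormal.ne_zero k
    ext i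
    exact congrFun h i
  have hmul : A.mulVec w = μ • w := hA.mulVec_eigenvectorBasis k
  set S := ∑ j, w j with hS
  have hi : ∀ i, S = (μ + 1) * w i := by
    intro i
    have h := congrFun hmul i
    simp only [Matrix.mulVec, dotProduct, hadj, Pi.smul_apply, smul_eq_mul] at h
    have h2 : ∑ j, (if i = j then (0 : ℝ) else 1) * w j = S - w i := by
      rw [eq_sub_iff_add_eq]
      have : w i = ∑ j, if i = j then w j else 0 := by simp
      rw [this, ← Finset.sum_add_distrib]
      refine Finset.sum_congr rfl fun j _ => ?_
      split_ifs <;> simp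
    rw [h2] at h
    linarith
  have hsum : n * S = (μ + 1) * S := by
    have := Finset.sum_congr rfl fun i (_ : i ∈ Finset.univ) => hi i
    rw [← Finset.mul_sum, ← hS, Finset.sum_const, Finset.card_fin, nsmul_eq_mul] at this
    exact this
  by_cases h0 : S = 0
  · obtain ⟨i, hwi⟩ := Function.ne_iff.1 hne
    have := hi i
    rw [h0] at this
    rcases mul_eq_zero.1 this.symm with h | h
    · left; linarith
    · exact absurd h hwi
  · right
    have := mul_right_cancel₀ h0 hsum
    linarith

/-- The trace vanishes, so the nonnegative numbers μ + 1 sum to n. If an index beyond the first had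
eigenvalue n - 1, so would the first, and two summands would already contribute 2n. -/
theorem secondEigenvalue_top_le (n : ℕ) : secondEigenvalue (⊤ : SimpleGraph (Fin n)) ≤ 1 := by
  classical
  unfold secondEigenvalue
  set hA := isHermitian_adjMatrix (⊤ : SimpleGraph (Fin n)) with hhA
  refine Real.iSup_le (fun ⟨i, hi⟩ => ?_) zero_le_one
  have hval : ∀ k, hA.eigenvalues₀ k = -1 ∨ hA.eigenvalues₀ k = n - 1 := by
    intro k
    have := eigenvalue_complete hA (fun i j => by
      simp [SimpleGraph.adjMatrix_apply, ite_not]) (Fintype.equivOfCardEq (Fintype.card_fin _) k)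
    simpa [Matrix.IsHermitian.eigenvalues] using this
  have hsum : ∑ k, hA.eigenvalues₀ k = 0 := by
    have h := hA.trace_eq_sum_eigenvalues
    rw [SimpleGraph.trace_adjMatrix] at h
    simp only [Matrix.IsHermitian.eigenvalues, RCLike.ofReal_real_eq_id, id] at h
    rw [h]
    exact (Equiv.sum_comp (Fintype.equivOfCardEq (Fintype.card_fin _)).symm _).symm
  have hn : 0 < n := by
    have := i.2; simp only [Fintype.card_fin] at this; omega
  rcases hval i with h | h
  · change |hA.eigenvalues₀ i| ≤ 1
    rw [h]; norm_num
  · exfalso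
    set z : Fin (Fintype.card (Fin n)) := ⟨0, by simpa using hn⟩
    have hz : hA.eigenvalues₀ i ≤ hA.eigenvalues₀ z :=
      hA.eigenvalues₀_antitone (Fin.mk_le_of_le_val (Nat.zero_le _))
    have hzi : z ≠ i := by rintro rfl; exact lt_irrefl _ hi
    have hn' : (0 : ℝ) < n := by exact_mod_cast hn
    have h1 : ∑ k, (hA.eigenvalues₀ k + 1) = n := by
      rw [Finset.sum_add_distrib, hsum]; simp
    have h2 : ∑ k ∈ {z, i}, (hA.eigenvalues₀ k + 1) ≤ ∑ k, (hA.eigenvalues₀ k + 1) :=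
      Finset.sum_le_univ_sum_of_nonneg fun k => by
        rcases hval k with h | h <;> rw [h] <;> linarith
    rw [Finset.sum_pair hzi, h1] at h2
    linarith

theorem isExpanderSequence_top : IsExpanderSequence fun _ => ⊤ := by
  classical
  have hdeg : ∀ n : ℕ, 1 ≤ n → (⊤ : SimpleGraph (Fin n)).maxDegree = n - 1 ∧
      (⊤ : SimpleGraph (Fin n)).minDegree = n - 1 := by
    intro n hn
    have : Nonempty (Fin n) := ⟨⟨0, hn⟩⟩
    have h : (⊤ : SimpleGraph (Fin n)).IsRegularOfDegree (n - 1) := by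
      simpa using SimpleGraph.IsRegularOfDegree.top (V := Fin n)
    exact ⟨by convert h.maxDegree_eq, by convert h.minDegree_eq⟩
  refine ⟨fun n hn => ?_, ?_, ?_⟩
  · have : Nonempty (Fin n) := ⟨⟨0, hn⟩⟩
    exact SimpleGraph.connected_top
  · refine tendsto_const_nhds.congr' ?_
    filter_upwards [eventually_ge_atTop 2] with n hn
    obtain ⟨h1, h2⟩ := hdeg n (by omega)
    have : ((n - 1 : ℕ) : ℝ) ≠ 0 := by
      have : n - 1 ≠ 0 := by omega
      exact_mod_cast this
    convert (div_self this).symm using 3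
    · convert h1
    · convert h2
  · have h1 : (fun n => secondEigenvalue (⊤ : SimpleGraph (Fin n))) =O[atTop]
        (fun _ => (1 : ℝ)) := by
      refine IsBigO.of_bound 1 (Eventually.of_forall fun n => ?_)
      have h0 : 0 ≤ secondEigenvalue (⊤ : SimpleGraph (Fin n)) :=
        Real.iSup_nonneg fun _ => abs_nonneg _
      rw [Real.norm_of_nonneg h0]
      simpa using secondEigenvalue_top_le n
    refine h1.trans_isLittleO ?_
    rw [isLittleO_const_left]
    right
    refine tendsto_norm_atTop_atTop.comp ?_
    refine (tendsto_natCast_atTop_atTop.comp (tendsto_sub_atTop_nat 1)).congr' ?_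
    filter_upwards [eventually_ge_atTop 1] with n hn
    rw [Function.comp_apply]
    congr 1
    convert (hdeg n hn).1.symm

/-! ### Lower bounds by distance on paths -/

theorem ae_callsLaw_adj {V : Type*} [Fintype V] [MeasurableSpace V] [MeasurableSingletonClass V]
    (G : SimpleGraph V) (q : unitInterval) :
    ∀ᵐ ω ∂callsLaw G q, ∀ (t : ℕ) (v : V), (ω (t, v)).1 = v ∨ G.Adj v (ω (t, v)).1 := by
  rw [ae_all_iff]
  intro t
  rw [ae_all_iff]
  intro v
  exact (measurePreserving_eval_infinitePi
    (fun p : ℕ × V => callLaw G q p.2) (t, v)).quasiMeasurePreserving.ae (ae_callLaw_adj G q v)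

/-- In one round the information moves along at most one edge, whichever end makes the call. -/
theorem informed_pathGraph {n : ℕ} {P : Protocol} {v u : Fin n} {ω : ℕ × Fin n → Fin n × Bool}
    (hω : ∀ (t : ℕ) (v : Fin n), (ω (t, v)).1 = v ∨ (SimpleGraph.pathGraph n).Adj v (ω (t, v)).1)
    {t : ℕ} (hu : u ∈ informed P v ω t) : (u : ℕ) ≤ v + t ∧ (v : ℕ) ≤ u + t := by
  induction t generalizing u with
  | zero =>
    obtain rfl : u = v := hu
    simp
  | succ t ih =>
    have hadj : ∀ x y : Fin n, (∃ b, ω (t, x) = (y, b)) → (y : ℕ) ≤ x + 1 ∧ (x : ℕ) ≤ y + 1 := by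
      rintro x y ⟨b, h⟩
      have := hω t x
      rw [h, SimpleGraph.pathGraph_adj] at this
      rcases this with h | h | h
      · simp only at h; subst h; simp
      · simp only at h; omega
      · simp only at h; omega
    rcases mem_informed_succ_iff.1 hu with h | ⟨w, hw, h⟩ | ⟨-, w, hw, h⟩
    · have := ih h; omega
    · have := ih hw
      have := hadj w u ⟨_, h⟩
      omega
    · have := ih hw
      have := hadj u w ⟨_, h⟩
      omega

/-- Serves the case `ε ≥ 1`: the runtime is almost surely linear in n, which beats every multiple of
log n. -/
theorem whpRuntimeAtLeast_pathGraph (P : Protocol) (q : unitInterval) (c : ℝ) :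
    WhpRuntimeAtLeast P SimpleGraph.pathGraph q c := by
  refine ⟨fun _ => 1, fun _ => one_pos, ?_, ?_⟩
  · rw [isLittleO_const_left]
    exact Or.inr (tendsto_norm_atTop_atTop.comp
      (Real.tendsto_log_atTop.comp tendsto_natCast_atTop_atTop))
  refine tendsto_const_nhds.congr' ?_
  have hlog : ∀ᶠ n : ℕ in atTop, c * Real.log n ≤ 1 / 4 * n := by
    have h1 : (fun n : ℕ => c * Real.log n) =o[atTop] (fun n : ℕ => (n : ℝ)) :=
      (Real.isLittleO_log_id_atTop.comp_tendsto tendsto_natCast_atTop_atTop).const_mul_left c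
    filter_upwards [h1.bound (by norm_num : (0 : ℝ) < 1 / 4)] with n hn
    simpa using (le_abs_self _).trans hn
  filter_upwards [hlog, eventually_ge_atTop 4] with n hn hn4
  have : Nonempty (Fin n) := ⟨⟨0, by omega⟩⟩
  rw [eq_comm, ← iInf_const (ι := Fin n) (a := (1 : ENNReal))]
  refine iInf_congr fun v => ?_
  rw [← measure_univ (μ := callsLaw (SimpleGraph.pathGraph n) q)]
  refine measure_congr (eventuallyEq_univ.2 ?_)
  filter_upwards [ae_callsLaw_adj (SimpleGraph.pathGraph n) q] with ω hω
  -- Reaching both ends of the path within t rounds requires n - 1 ≤ 2t, but here 2t ≤ n - 2.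
  have hne : informed P v ω ((n - 2) / 2) ≠ Set.univ := by
    intro h
    have h1 := informed_pathGraph hω (h ▸ Set.mem_univ (⟨0, by omega⟩ : Fin n))
    have h2 := informed_pathGraph hω (h ▸ Set.mem_univ (⟨n - 1, by omega⟩ : Fin n))
    simp only at h1 h2
    omega
  refine le_trans ?_ (le_runtime hne)
  have h4 : (n : ℝ) ≤ 4 * (((n - 2) / 2 : ℕ) : ℝ) + 4 := by
    have : n ≤ 4 * ((n - 2) / 2) + 4 := by omega
    exact_mod_cast this
  exact EReal.coe_le_coe_iff.2 (by linarith)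

theorem connected_pathGraph_of_one_le {n : ℕ} (hn : 1 ≤ n) :
    (SimpleGraph.pathGraph n).Connected := by
  obtain ⟨m, rfl⟩ := Nat.exists_eq_add_of_le' hn
  exact SimpleGraph.pathGraph_connected m

/-! ### The modified complete graph -/

/-- The graph on `Fin n` obtained from the complete graph by deleting all edges between the vertices
below `a` and the vertices below `d`. -/
def threeBlockGraph (n a d : ℕ) : SimpleGraph (Fin n) where
  Adj i j := i ≠ j ∧ (d ≤ i.val ∨ d ≤ j.val ∨ (a ≤ i.val ∧ a ≤ j.val))
  symm := ⟨fun i j h => ⟨h.1.symm, by tauto⟩⟩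
  loopless := ⟨fun i h => h.1 rfl⟩

section ThreeBlock

variable {n a d : ℕ}

theorem threeBlockGraph_adj {i j : Fin n} : (threeBlockGraph n a d).Adj i j ↔
    i.val ≠ j.val ∧ (d ≤ i.val ∨ d ≤ j.val ∨ (a ≤ i.val ∧ a ≤ j.val)) := by
  simp [threeBlockGraph, Fin.ext_iff]

theorem threeBlockGraph_connected (hd : d < n) : (threeBlockGraph n a d).Connected := by
  have : Nonempty (Fin n) := ⟨⟨d, hd⟩⟩
  have h : ∀ i, (threeBlockGraph n a d).Reachable i ⟨d, hd⟩ := by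
    intro i
    by_cases hi : i = ⟨d, hd⟩
    · rw [hi]
    · exact SimpleGraph.Adj.reachable ⟨hi, Or.inr (Or.inl le_rfl)⟩
  exact ⟨fun i j => (h i).trans (h j).symm⟩

open Classical in
theorem degree_threeBlockGraph_of_lt (had : a ≤ d) (hd : d < n) {i : Fin n} (hi : i.val < a) :
    (threeBlockGraph n a d).degree i = n - d := by
  have : (threeBlockGraph n a d).neighborFinset i = Finset.Ici ⟨d, hd⟩ := by
    ext j
    simp only [SimpleGraph.mem_neighborFinset, threeBlockGraph_adj, Finset.mem_Ici, Fin.le_def,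
      ne_eq]
    omega
  rw [← SimpleGraph.card_neighborFinset_eq_degree, this, Fin.card_Ici]

open Classical in
theorem degree_threeBlockGraph_of_ge {i : Fin n} (hi : d ≤ i.val) :
    (threeBlockGraph n a d).degree i = n - 1 := by
  have : (threeBlockGraph n a d).neighborFinset i = Finset.univ.erase i := by
    ext j
    simp only [SimpleGraph.mem_neighborFinset, threeBlockGraph_adj, Finset.mem_erase, Finset.mem_univ,
      and_true, ne_eq, Fin.ext_iff]
    omega
  rw [← SimpleGraph.card_neighborFinset_eq_degree, this, Finset.card_erase_of_mem
    (Finset.mem_univ i), Finset.card_fin]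

open Classical in
theorem degree_threeBlockGraph_of_mem (had : a ≤ d) (hd : d < n) {i : Fin n} (hi : a ≤ i.val)
    (hi' : i.val < d) : (threeBlockGraph n a d).degree i = n - a - 1 := by
  have : (threeBlockGraph n a d).neighborFinset i =
      (Finset.Ici (⟨a, had.trans_lt hd⟩ : Fin n)).erase i := by
    ext j
    simp only [SimpleGraph.mem_neighborFinset, threeBlockGraph_adj, Finset.mem_erase, Finset.mem_Ici,
      Fin.le_def, ne_eq, Fin.ext_iff]
    omega
  rw [← SimpleGraph.card_neighborFinset_eq_degree, this, Finset.card_erase_of_mem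
    (by simpa [Fin.le_def] using hi), Fin.card_Ici]

open Classical in
theorem le_degree_threeBlockGraph (had : a ≤ d) (hd : d < n) (i : Fin n) :
    n - 1 - d ≤ (threeBlockGraph n a d).degree i := by
  by_cases h1 : i.val < a
  · rw [degree_threeBlockGraph_of_lt had hd h1]; omega
  by_cases h2 : i.val < d
  · rw [degree_threeBlockGraph_of_mem had hd (not_lt.1 h1) h2]; omega
  · rw [degree_threeBlockGraph_of_ge (not_lt.1 h2)]; omega

open Classical in
theorem degree_threeBlockGraph_pos (had : a ≤ d) (hd : d < n) (hn : 2 ≤ n) (i : Fin n) :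
    0 < (threeBlockGraph n a d).degree i := by
  by_cases h1 : i.val < a
  · rw [degree_threeBlockGraph_of_lt had hd h1]; omega
  by_cases h2 : i.val < d
  · rw [degree_threeBlockGraph_of_mem had hd (not_lt.1 h1) h2]; omega
  · rw [degree_threeBlockGraph_of_ge (not_lt.1 h2)]; omega

theorem isDeletionKeeping_threeBlockGraph {ε : ℝ} (had : a ≤ d) (hd : d < n)
    (hdε : (d : ℝ) ≤ ε * (n - 1)) : IsDeletionKeeping (1 - ε) ⊤ (threeBlockGraph n a d) := by
  classical
  refine ⟨le_top, fun v => ?_⟩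
  have h1 : (⊤ : SimpleGraph (Fin n)).degree v = n - 1 := by
    simp
  have h2 := le_degree_threeBlockGraph had hd v
  have h3 : (1 - ε) * ((n - 1 : ℕ) : ℝ) ≤ ((n - 1 - d : ℕ) : ℝ) := by
    rw [Nat.cast_sub (show d ≤ n - 1 by omega), Nat.cast_sub (show 1 ≤ n by omega), Nat.cast_one]
    linarith
  calc (1 - ε) * _ = (1 - ε) * ((n - 1 : ℕ) : ℝ) := by rw [← h1]; congr!
    _ ≤ ((n - 1 - d : ℕ) : ℝ) := h3
    _ ≤ _ := by
      refine Nat.cast_le.2 (h2.trans_eq ?_)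
      congr!

variable (q : unitInterval)

theorem callProb_threeBlockGraph_eq_zero (had : a ≤ d) (hd : d < n) (hn : 2 ≤ n) {v u : Fin n}
    (hu : u.val < a) (hv : v.val < d) : callProb (threeBlockGraph n a d) q v u = 0 := by
  classical
  rw [callProb_eq _ _ (degree_threeBlockGraph_pos had hd hn v), if_neg]
  rw [threeBlockGraph_adj]
  omega

theorem callProb_threeBlockGraph_of_ge (had : a ≤ d) (hd : d < n) (hn : 2 ≤ n) {v u : Fin n}
    (hu : u.val < a) (hv : d ≤ v.val) :
    callProb (threeBlockGraph n a d) q v u = q / (n - 1) := by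
  classical
  rw [callProb_eq _ _ (degree_threeBlockGraph_pos had hd hn v), if_pos,
    degree_threeBlockGraph_of_ge hv, Nat.cast_sub (by omega), Nat.cast_one]
  refine ⟨?_, Or.inl hv⟩
  rintro rfl
  omega

/-- Only the `a` sparse vertices have the small degree n - d; all others have degree at least n - a
- 1. For a = o(n) and d/n bounded away from 1 the bound is q(1 + o(1)), which is why the sparse
block is chosen much smaller than the block of size `d`. -/
theorem sum_callProb_threeBlockGraph_le (had : a ≤ d) (hd : d < n) (ha : a + 1 < n)
    (v : Fin n) : ∑ u, callProb (threeBlockGraph n a d) q u v ≤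
      q * (a / (n - d) + (n - a) / (n - a - 1)) := by
  classical
  have hq : 0 ≤ (q : ℝ) := q.2.1
  have hd' : (d : ℝ) + 1 ≤ n := by exact_mod_cast hd
  have ha' : (a : ℝ) + 1 + 1 ≤ n := by exact_mod_cast ha
  have hle : ∀ u : Fin n, callProb (threeBlockGraph n a d) q u v ≤
      if u ∈ Finset.Iio (⟨a, by omega⟩ : Fin n) then (q : ℝ) / (n - d) else q / (n - a - 1) := by
    intro u
    have h0 : callProb (threeBlockGraph n a d) q u v ≤
        q / ((threeBlockGraph n a d).degree u : ℝ) := by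
      rw [callProb_eq _ _ (degree_threeBlockGraph_pos had hd (by omega) u)]
      split_ifs
      · exact le_rfl
      · positivity
    refine h0.trans ?_
    simp only [Finset.mem_Iio, Fin.lt_def]
    split_ifs with h1
    · rw [degree_threeBlockGraph_of_lt had hd h1, Nat.cast_sub hd.le]
    · have h2 : n - a - 1 ≤ (threeBlockGraph n a d).degree u := by
        by_cases h2 : u.val < d
        · rw [degree_threeBlockGraph_of_mem had hd (not_lt.1 h1) h2]
        · rw [degree_threeBlockGraph_of_ge (not_lt.1 h2)]; omega
      have h3 : (n : ℝ) - a - 1 ≤ ((threeBlockGraph n a d).degree u : ℝ) := by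
        have : ((n - a - 1 : ℕ) : ℝ) = (n : ℝ) - a - 1 := by
          rw [Nat.cast_sub (by omega), Nat.cast_sub (by omega), Nat.cast_one]
        rw [← this]; exact_mod_cast h2
      exact div_le_div_of_nonneg_left hq (by linarith) h3
  refine (Finset.sum_le_sum fun u _ => hle u).trans_eq ?_
  rw [Finset.sum_ite, Finset.sum_const, Finset.sum_const, Finset.filter_mem_eq_inter,
    Finset.univ_inter, Fin.card_Iio]
  have : (Finset.univ.filter fun u : Fin n => u ∉ Finset.Iio (⟨a, by omega⟩ : Fin n)) =
      Finset.Ici ⟨a, by omega⟩ := by ext u; simp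
  rw [this, Fin.card_Ici, nsmul_eq_mul, nsmul_eq_mul, Nat.cast_sub (by omega)]
  ring

/-- Apart from the call of `u` itself, only the n - d vertices from `d` on matter, and each of them
calls `u` successfully with probability q/(n - 1). -/
theorem prod_callLaw_real_avoid (P : Protocol) (had : a ≤ d) (hd : d < n) (hn : 2 ≤ n)
    {u : Fin n} (hu : u.val < a) :
    ∏ v, (callLaw (threeBlockGraph n a d) q v).real (avoid P u v) =
      ownCallHarmless P q * (1 - q / (n - 1)) ^ (n - d) := by
  classical
  have hval : ∀ v : Fin n, (callLaw (threeBlockGraph n a d) q v).real (avoid P u v) =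
      (if v = u then ownCallHarmless P q else 1) *
        if v ∈ Finset.Ici (⟨d, hd⟩ : Fin n) then (1 - (q : ℝ) / (n - 1)) else 1 := by
    intro v
    simp only [Finset.mem_Ici, Fin.le_def]
    by_cases h : v = u
    · subst h
      rw [callLaw_real_avoid_self, if_pos rfl, if_neg (by omega), mul_one]
    · rw [callLaw_real_avoid_of_ne _ _ _ h, if_neg h, one_mul]
      split_ifs with hv
      · rw [callProb_threeBlockGraph_of_ge q had hd hn hu hv]
      · rw [callProb_threeBlockGraph_eq_zero q had hd hn hu (not_le.1 hv), sub_zero]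
  rw [Finset.prod_congr rfl fun v _ => hval v, Finset.prod_mul_distrib, Finset.prod_ite_eq',
    if_pos (Finset.mem_univ u), Finset.prod_ite_mem, Finset.univ_inter, Finset.prod_const,
    Fin.card_Ici]

theorem measureReal_informed_threeBlockGraph_le (P : Protocol) (ha0 : 0 < a) (had : a ≤ d)
    (hd : d < n) (ha : a + 1 < n) {γ : ℝ}
    (hγ : 1 + q + pullFactor P * (q * (a / (n - d) + (n - a) / (n - a - 1))) ≤ γ)
    (v : Fin n) (t₁ t₂ : ℕ)
    (hpos : 0 < (ownCallHarmless P q * (1 - q / (n - 1)) ^ (n - d) : ℝ) ^ t₂) :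
    (callsLaw (threeBlockGraph n a d) q).real {ω | informed P v ω (t₁ + t₂) = Set.univ} ≤
      4 / (a * (ownCallHarmless P q * (1 - q / (n - 1)) ^ (n - d)) ^ t₂) + 2 * γ ^ t₁ / a := by
  have hcard : (Finset.Iio (⟨a, by omega⟩ : Fin n)).card = a := by rw [Fin.card_Iio]
  have hmem : ∀ u ∈ Finset.Iio (⟨a, by omega⟩ : Fin n), u.val < a := by simp [Fin.lt_def]
  have h := measureReal_informed_eq_univ_le (threeBlockGraph n a d) q P
    (Finset.Iio (⟨a, by omega⟩ : Fin n)) (by rw [← Finset.card_pos, hcard]; exact ha0)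
    (fun u hu w hw => callProb_threeBlockGraph_eq_zero q had hd (by omega) (hmem w hw)
      ((hmem u hu).trans_le had))
    (fun u hu => prod_callLaw_real_avoid q P had hd (by omega) (hmem u hu))
    (γ := γ) (fun w => le_trans ?_ hγ) v t₁ t₂ hpos
  · rwa [hcard] at h
  · have h3 : 0 ≤ pullFactor P := by cases P <;> simp [pullFactor]
    have := mul_le_mul_of_nonneg_left (sum_callProb_threeBlockGraph_le q had hd ha w) h3
    linarith

end ThreeBlock

/-! ### Numerical inequalities -/

/-- By concavity of log, the graph of -log(1 - q) lies below its chord from 0 to `c`, so a linear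
bound need only be checked at `c`. -/
theorem neg_log_one_sub_le {q c K : ℝ} (hq : 0 ≤ q) (hqc : q ≤ c) (hc0 : 0 < c) (hc : c < 1)
    (hK : -Real.log (1 - c) ≤ K * c) : -Real.log (1 - q) ≤ K * q := by
  have h := strictConcaveOn_log_Ioi.concaveOn.2 (Set.mem_Ioi.2 zero_lt_one)
    (Set.mem_Ioi.2 (sub_pos.2 hc)) (sub_nonneg.2 ((div_le_one hc0).2 hqc)) (div_nonneg hq hc0.le)
    (by ring)
  simp only [smul_eq_mul, Real.log_one, mul_zero, zero_add] at h
  have h1 : (1 - q / c) * 1 + q / c * (1 - c) = 1 - q := by field_simp; ring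
  rw [h1] at h
  have h2 : q / c * -Real.log (1 - c) ≤ q / c * (K * c) :=
    mul_le_mul_of_nonneg_left hK (div_nonneg hq hc0.le)
  have h3 : q / c * (K * c) = K * q := by field_simp
  linarith

/-- With D = q - log(1 - q), this is 1/(8q) - q³/5 ≤ q/D² with denominators cleared, the form needed
in `pushPull_constant_lt`. -/
theorem sq_mul_le_of_lt_one {q : ℝ} (hq0 : 0 < q) (hq1 : q < 1) :
    (q - Real.log (1 - q)) ^ 2 * (5 - 8 * q ^ 4) ≤ 40 * q ^ 2 := by
  have hl2 := Real.log_two_lt_d9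
  have hL : 0 ≤ -Real.log (1 - q) := by
    have := Real.log_nonpos (by linarith : (0 : ℝ) ≤ 1 - q) (by linarith)
    linarith
  have hbound : ∀ K : ℝ, -Real.log (1 - q) ≤ K * q →
      (q - Real.log (1 - q)) ^ 2 ≤ (1 + K) ^ 2 * q ^ 2 := by
    intro K hK
    rw [← mul_pow]
    exact pow_le_pow_left₀ (by linarith) (by linarith) 2
  -- Chord bounds give D ≤ 2.82q up to 7/10, where 5 · 2.82² < 40, and D ≤ 3.6q up to 9/10, where 5
  -- - 8q⁴ ≤ 3.0792 and 3.6² · 3.0792 < 40. Beyond 9/10 the factor 5 - 8q⁴ is negative.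
  rcases le_total q (7 / 10) with h | h
  · have h1 : -Real.log (1 - 7 / 10) ≤ 1.82 * (7 / 10) := by
      have e : -Real.log (1 - 7 / 10) = 2 * Real.log 2 + Real.log (5 / 6) := by
        rw [← Real.log_inv, two_mul, ← Real.log_mul (by norm_num) (by norm_num),
          ← Real.log_mul (by norm_num) (by norm_num)]
        norm_num
      have := Real.log_le_sub_one_of_pos (by norm_num : (0 : ℝ) < 5 / 6)
      rw [e]; norm_num at *; linarith
    have h2 := hbound _ (neg_log_one_sub_le hq0.le h (by norm_num) (by norm_num) h1)
    have h3 : 0 ≤ (q - Real.log (1 - q)) ^ 2 * q ^ 4 := by positivity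
    have h4 := sq_nonneg q
    norm_num at h2
    nlinarith
  rcases le_total q (9 / 10) with h' | h'
  · have h1 : -Real.log (1 - 9 / 10) ≤ 2.6 * (9 / 10) := by
      have e : -Real.log (1 - 9 / 10) = 3 * Real.log 2 + Real.log (5 / 4) := by
        rw [← Real.log_inv, show (3 : ℝ) * Real.log 2 = Real.log (2 ^ 3) by
          rw [Real.log_pow]; norm_num, ← Real.log_mul (by norm_num) (by norm_num)]
        norm_num
      have := Real.log_le_sub_one_of_pos (by norm_num : (0 : ℝ) < 5 / 4)
      rw [e]; norm_num at *; linarith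
    have h2 := hbound _ (neg_log_one_sub_le hq0.le h' (by norm_num) (by norm_num) h1)
    have h3 : (7 / 10 : ℝ) ^ 4 ≤ q ^ 4 := pow_le_pow_left₀ (by norm_num) h 4
    have h4 := sq_nonneg q
    have h5 : (q - Real.log (1 - q)) ^ 2 * (5 - 8 * q ^ 4) ≤
        (q - Real.log (1 - q)) ^ 2 * (5 - 8 * (7 / 10) ^ 4) :=
      mul_le_mul_of_nonneg_left (by linarith) (sq_nonneg _)
    norm_num at h2 h5 ⊢
    linarith
  · have h3 : (9 / 10 : ℝ) ^ 4 ≤ q ^ 4 := pow_le_pow_left₀ (by norm_num) h' 4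
    have h4 := sq_nonneg q
    have h5 : (q - Real.log (1 - q)) ^ 2 * (5 - 8 * q ^ 4) ≤ 0 :=
      mul_nonpos_of_nonneg_of_nonpos (sq_nonneg _) (by norm_num at h3; linarith)
    linarith

theorem push_constant_lt {ε q : ℝ} (hε0 : 0 < ε) (hε1 : ε < 1) (hq0 : 0 < q) :
    cPush q + ε / (2 * q) < 1 / Real.log (1 + q) + 1 / (q * (1 - ε)) := by
  have h : 1 / q + ε / (2 * q) < 1 / (q * (1 - ε)) := by
    have h1 : 1 / q + ε / (2 * q) = (1 + ε / 2) / q := by field_simp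
    have h2 : 1 + ε / 2 < 1 / (1 - ε) := by
      rw [lt_div_iff₀ (by linarith)]
      nlinarith
    rw [h1, mul_comm, ← div_div]
    exact div_lt_div_of_pos_right h2 hq0
  unfold cPush
  linarith

theorem pushPull_constant_lt {ε q : ℝ} (hε0 : 0 < ε) (hε1 : ε < 1) (hq0 : 0 < q) (hq1 : q < 1) :
    cPP q + (ε / (8 * q) - ε * q ^ 3 / 5) <
      1 / Real.log (1 + 2 * q) + 1 / (q * (1 - ε) - Real.log (1 - q)) := by
  have hL : 0 < -Real.log (1 - q) := by
    have := Real.log_neg (by linarith : (0 : ℝ) < 1 - q) (by linarith)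
    linarith
  have hsq := sq_mul_le_of_lt_one hq0 hq1
  rw [cPP, if_neg hq1.ne]
  set D := q - Real.log (1 - q) with hD
  have hDq : q < D := by linarith
  have hqe : q * ε < q := by nlinarith
  have hqe0 : 0 < q * ε := mul_pos hq0 hε0
  have e1 : q * (1 - ε) - Real.log (1 - q) = D - q * ε := by rw [hD]; ring
  have h1 : 1 / (D - q * ε) - 1 / D = q * ε / (D * (D - q * ε)) := by
    have h3 : D - q * ε ≠ 0 := by linarith
    have h4 : D ≠ 0 := by linarith
    field_simp
    ring
  -- The gain 1/(D - qε) - 1/D strictly exceeds its linearisation qε/D²; this is the slack that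
  -- allows a strict inequality.
  have h2 : q * ε / D ^ 2 < q * ε / (D * (D - q * ε)) := by
    apply div_lt_div_of_pos_left hqe0
    · exact mul_pos (by linarith) (by linarith)
    · nlinarith
  have h3 : ε / (8 * q) - ε * q ^ 3 / 5 ≤ q * ε / D ^ 2 := by
    have e2 : ε / (8 * q) - ε * q ^ 3 / 5 = ε * (5 - 8 * q ^ 4) / (40 * q) := by
      field_simp; ring
    rw [e2, div_le_div_iff₀ (by linarith) (by nlinarith)]
    nlinarith [mul_le_mul_of_nonneg_left hsq hε0.le]
  rw [e1]
  linarith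

/-! ### The sizes of the blocks -/

/-- The number of vertices to which the sparse vertices are not adjacent. -/
noncomputable def deletedSize (ε : ℝ) (n : ℕ) : ℕ := ⌊ε * (n - 1)⌋₊

/-- The number of sparse vertices. -/
noncomputable def sparseSize (ε : ℝ) (n : ℕ) : ℕ := ⌊ε * (n - 1) / (1 + Real.log n)⌋₊

section Sizes

variable {ε : ℝ}

theorem deletedSize_le (hε0 : 0 < ε) {n : ℕ} (hn : 1 ≤ n) :
    (deletedSize ε n : ℝ) ≤ ε * (n - 1) := by
  have : (1 : ℝ) ≤ n := by exact_mod_cast hn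
  exact Nat.floor_le (mul_nonneg hε0.le (by linarith))

theorem deletedSize_lt (hε0 : 0 < ε) (hε1 : ε < 1) {n : ℕ} (hn : 1 ≤ n) : deletedSize ε n < n := by
  have h1 : (1 : ℝ) ≤ n := by exact_mod_cast hn
  have h2 := deletedSize_le hε0 hn
  have : (deletedSize ε n : ℝ) < n := by nlinarith
  exact_mod_cast this

/-- The summand 1 in the denominator 1 + log n keeps it at least 1 for every n ≥ 1. -/
theorem sparseSize_le_deletedSize (hε0 : 0 < ε) {n : ℕ} (hn : 1 ≤ n) :
    sparseSize ε n ≤ deletedSize ε n := by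
  have h1 : (1 : ℝ) ≤ n := by exact_mod_cast hn
  refine Nat.floor_mono (div_le_self (mul_nonneg hε0.le (by linarith)) ?_)
  have := Real.log_nonneg h1
  linarith

theorem tendsto_deletedSize_div (hε0 : 0 < ε) :
    Tendsto (fun n : ℕ => (deletedSize ε n : ℝ) / n) atTop (𝓝 ε) := by
  have hinv := tendsto_inv_atTop_nhds_zero_nat (𝕜 := ℝ)
  have hl : Tendsto (fun n : ℕ => ε - (ε + 1) * (n : ℝ)⁻¹) atTop (𝓝 ε) := by
    simpa using (tendsto_const_nhds (x := ε)).sub (hinv.const_mul (ε + 1))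
  refine tendsto_of_tendsto_of_tendsto_of_le_of_le' hl tendsto_const_nhds ?_ ?_
  · filter_upwards [eventually_ge_atTop 1] with n hn
    have h1 : (0 : ℝ) < n := by exact_mod_cast hn
    have h2 : ε * (n - 1) < deletedSize ε n + 1 := Nat.lt_floor_add_one _
    rw [le_div_iff₀ h1]
    have : (ε - (ε + 1) * (n : ℝ)⁻¹) * n = ε * n - (ε + 1) := by field_simp
    rw [this]; linarith
  · filter_upwards [eventually_ge_atTop 1] with n hn
    have h1 : (0 : ℝ) < n := by exact_mod_cast hn
    rw [div_le_iff₀ h1]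
    have := deletedSize_le hε0 hn
    linarith

theorem tendsto_log_natCast : Tendsto (fun n : ℕ => Real.log n) atTop atTop :=
  Real.tendsto_log_atTop.comp tendsto_natCast_atTop_atTop

theorem tendsto_sparseSize_div (hε0 : 0 < ε) :
    Tendsto (fun n : ℕ => (sparseSize ε n : ℝ) / n) atTop (𝓝 0) := by
  have hu : Tendsto (fun n : ℕ => ε / (1 + Real.log n)) atTop (𝓝 0) :=
    tendsto_const_nhds.div_atTop (tendsto_atTop_add_const_left _ _ tendsto_log_natCast)
  refine tendsto_of_tendsto_of_tendsto_of_le_of_le' tendsto_const_nhds hu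
    (Eventually.of_forall fun n => by positivity) ?_
  filter_upwards [eventually_ge_atTop 1] with n hn
  have h1 : (1 : ℝ) ≤ n := by exact_mod_cast hn
  have h0 := Real.log_nonneg h1
  have h2 : (sparseSize ε n : ℝ) ≤ ε * (n - 1) / (1 + Real.log n) :=
    Nat.floor_le (div_nonneg (mul_nonneg hε0.le (by linarith)) (by linarith))
  rw [div_le_iff₀ (by linarith), div_mul_eq_mul_div]
  refine h2.trans (div_le_div_of_nonneg_right ?_ (by linarith))
  linarith

theorem tendsto_sparseSize_div_rpow (hε0 : 0 < ε) {θ : ℝ} (hθ0 : 0 ≤ θ) (hθ1 : θ < 1) :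
    Tendsto (fun n : ℕ => (sparseSize ε n : ℝ) / (n : ℝ) ^ θ) atTop atTop := by
  -- One factor n^δ absorbs 1 + log n, and the other one tends to infinity.
  set δ := (1 - θ) / 2 with hδ
  have hδ0 : 0 < δ := by rw [hδ]; linarith
  have hpow : Tendsto (fun n : ℕ => (n : ℝ) ^ δ) atTop atTop :=
    (tendsto_rpow_atTop hδ0).comp tendsto_natCast_atTop_atTop
  have hlog : ∀ᶠ n : ℕ in atTop, 1 + Real.log n ≤ (n : ℝ) ^ δ := by
    have h1 : (fun n : ℕ => Real.log n) =o[atTop] (fun n : ℕ => (n : ℝ) ^ δ) :=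
      (isLittleO_log_rpow_atTop hδ0).comp_tendsto tendsto_natCast_atTop_atTop
    filter_upwards [h1.bound (by norm_num : (0 : ℝ) < 1 / 2), hpow.eventually_ge_atTop 2]
      with n hn h2
    have h3 := (le_abs_self _).trans hn
    rw [Real.norm_of_nonneg (by linarith)] at h3
    linarith
  have hlow : Tendsto (fun n : ℕ => ε / 2 * (n : ℝ) ^ δ - 1) atTop atTop :=
    tendsto_atTop_add_const_right _ _ (hpow.const_mul_atTop (by linarith))
  refine tendsto_atTop_mono' _ ?_ hlow
  filter_upwards [hlog, eventually_ge_atTop 2] with n hn hn2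
  have h1 : (2 : ℝ) ≤ n := by exact_mod_cast hn2
  have h0 := Real.log_nonneg (by linarith : (1 : ℝ) ≤ n)
  have hθpos : 0 < (n : ℝ) ^ θ := Real.rpow_pos_of_pos (by linarith) _
  have hδpos : 0 < (n : ℝ) ^ δ := Real.rpow_pos_of_pos (by linarith) _
  have hθone : 1 ≤ (n : ℝ) ^ θ := Real.one_le_rpow (by linarith) hθ0
  have h2 : ε * (n - 1) / (1 + Real.log n) < sparseSize ε n + 1 := Nat.lt_floor_add_one _
  have hprod : (n : ℝ) ^ δ * (n : ℝ) ^ θ * (n : ℝ) ^ δ = n := by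
    rw [← Real.rpow_add (by linarith), ← Real.rpow_add (by linarith),
      show δ + θ + δ = 1 by rw [hδ]; ring, Real.rpow_one]
  have h3 : ε / 2 * (n : ℝ) ^ δ * (n : ℝ) ^ θ ≤ ε * (n - 1) / (1 + Real.log n) := by
    rw [le_div_iff₀ (by linarith)]
    calc ε / 2 * (n : ℝ) ^ δ * (n : ℝ) ^ θ * (1 + Real.log n)
        ≤ ε / 2 * (n : ℝ) ^ δ * (n : ℝ) ^ θ * (n : ℝ) ^ δ :=
          mul_le_mul_of_nonneg_left hn (by positivity)
      _ = ε / 2 * ((n : ℝ) ^ δ * (n : ℝ) ^ θ * (n : ℝ) ^ δ) := by ring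
      _ = ε / 2 * n := by rw [hprod]
      _ ≤ ε * (n - 1) := by nlinarith
  rw [le_div_iff₀ hθpos]
  linarith

end Sizes

/-! ### Runtime lower bounds on the modified complete graphs -/

/-- The modified complete graphs. -/
noncomputable def slowGraph (ε : ℝ) (n : ℕ) : SimpleGraph (Fin n) :=
  threeBlockGraph n (sparseSize ε n) (deletedSize ε n)

theorem WhpRuntimeAtLeast.mono {P : Protocol} {G : (n : ℕ) → SimpleGraph (Fin n)}
    {q : unitInterval} {c c' : ℝ} (h : WhpRuntimeAtLeast P G q c') (hc : c ≤ c') :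
    WhpRuntimeAtLeast P G q c := by
  obtain ⟨f, hf0, hf, ht⟩ := h
  refine ⟨f, hf0, hf, tendsto_of_tendsto_of_tendsto_of_le_of_le' ht tendsto_const_nhds
    (Eventually.of_forall fun n => iInf_mono fun v => measure_mono fun ω hω => ?_) ?_⟩
  · refine le_trans (EReal.coe_le_coe_iff.2 ?_) hω
    have := mul_le_mul_of_nonneg_right hc (Real.log_natCast_nonneg n)
    linarith
  · filter_upwards [eventually_ge_atTop 1] with n hn
    exact (iInf_le _ ⟨0, hn⟩).trans prob_le_one

/-- It suffices to bound the probability that all vertices are informed after `t n` rounds. -/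
theorem whpRuntimeAtLeast_of_measureReal_le {P : Protocol} {G : (n : ℕ) → SimpleGraph (Fin n)}
    {q : unitInterval} {c C : ℝ} (hC : 0 < C) (t : ℕ → ℕ) (err : ℕ → ℝ)
    (ht : ∀ n : ℕ, c * Real.log n - C ≤ t n) (herr : Tendsto err atTop (𝓝 0))
    (h : ∀ᶠ n in atTop, ∀ v : Fin n,
      (callsLaw (G n) q).real {ω | informed P v ω (t n) = Set.univ} ≤ err n) :
    WhpRuntimeAtLeast P G q c := by
  refine ⟨fun _ => C, fun _ => hC, ?_, ?_⟩
  · rw [isLittleO_const_left]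
    exact Or.inr (tendsto_norm_atTop_atTop.comp tendsto_log_natCast)
  have hlow : Tendsto (fun n => ENNReal.ofReal (1 - err n)) atTop (𝓝 1) := by
    have := ENNReal.tendsto_ofReal ((tendsto_const_nhds (x := (1 : ℝ))).sub herr)
    simpa using this
  refine tendsto_of_tendsto_of_tendsto_of_le_of_le' hlow tendsto_const_nhds ?_ ?_
  · filter_upwards [h] with n hn
    refine le_iInf fun v => ?_
    have hmeas : MeasurableSet {ω : ℕ × Fin n → Fin n × Bool | informed P v ω (t n) = Set.univ} := by
      refine DeterminedBy.measurableSet (S := Finset.range (t n) ×ˢ Finset.univ) fun ω ω' hω h => ?_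
      rw [Set.mem_ofPred_eq] at h ⊢
      rwa [← informed_congr P v (t n) hω]
    have h1 : 1 - err n ≤
        (callsLaw (G n) q).real {ω | informed P v ω (t n) = Set.univ}ᶜ := by
      rw [probReal_compl_eq_one_sub hmeas]
      linarith [hn v]
    refine (ENNReal.ofReal_le_ofReal h1).trans ?_
    rw [ofReal_measureReal]
    refine measure_mono fun ω hω => ?_
    exact le_trans (EReal.coe_le_coe_iff.2 (ht n)) (le_runtime hω)
  · filter_upwards [eventually_ge_atTop 1] with n hn
    exact (iInf_le _ ⟨0, hn⟩).trans prob_le_one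

theorem tendsto_pull_rate {ε : ℝ} (hε0 : 0 < ε) (hε1 : ε < 1) :
    Tendsto (fun n : ℕ => (sparseSize ε n : ℝ) / (n - deletedSize ε n) +
      (n - sparseSize ε n) / (n - sparseSize ε n - 1)) atTop (𝓝 1) := by
  have ha := tendsto_sparseSize_div hε0
  have hd := tendsto_deletedSize_div hε0
  have hinv := tendsto_inv_atTop_nhds_zero_nat (𝕜 := ℝ)
  have h1 := (ha.div ((tendsto_const_nhds (x := (1 : ℝ))).sub hd) (by linarith)).add
    (((tendsto_const_nhds (x := (1 : ℝ))).sub ha).div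
      (((tendsto_const_nhds (x := (1 : ℝ))).sub ha).sub hinv) (by norm_num))
  norm_num at h1
  refine h1.congr' ?_
  filter_upwards [eventually_ge_atTop 1] with n hn
  have hn0 : (n : ℝ) ≠ 0 := by
    have : n ≠ 0 := by omega
    exact_mod_cast this
  have e1 : (1 : ℝ) - (deletedSize ε n : ℝ) / n = (n - deletedSize ε n) / n := by field_simp
  have e2 : (1 : ℝ) - (sparseSize ε n : ℝ) / n = (n - sparseSize ε n) / n := by field_simp
  have e3 : (1 : ℝ) - (sparseSize ε n : ℝ) / n - (n : ℝ)⁻¹ = (n - sparseSize ε n - 1) / n := by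
    field_simp
  rw [e3, e1, e2, div_div_div_cancel_right₀ hn0, div_div_div_cancel_right₀ hn0]

theorem eventually_exp_neg_le_pow {ε q r : ℝ} (hε0 : 0 < ε) (hε1 : ε < 1) (hq0 : 0 < q)
    (hr : q * (1 - ε) < r) :
    ∀ᶠ n : ℕ in atTop, Real.exp (-r) ≤ (1 - q / (n - 1)) ^ (n - deletedSize ε n) := by
  have hd := tendsto_deletedSize_div hε0
  have hinv := tendsto_inv_atTop_nhds_zero_nat (𝕜 := ℝ)
  have hlim : Tendsto (fun n : ℕ => q * (1 - (deletedSize ε n : ℝ) / n) /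
      (1 - (1 + q) * (n : ℝ)⁻¹)) atTop (𝓝 (q * (1 - ε))) := by
    have := (((tendsto_const_nhds (x := (1 : ℝ))).sub hd).const_mul q).div
      ((tendsto_const_nhds (x := (1 : ℝ))).sub (hinv.const_mul (1 + q))) (by norm_num)
    simpa [Pi.div_def] using this
  filter_upwards [hlim.eventually_lt_const hr, eventually_gt_atTop ⌈1 + q⌉₊,
    eventually_ge_atTop 1] with n hn hnq hn1
  have hnq' : 1 + q < n := Nat.lt_of_ceil_lt hnq
  have hn0 : (0 : ℝ) < n := by linarith
  have hdn := (deletedSize_lt hε0 hε1 hn1).le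
  have hx : 0 < 1 - q / ((n : ℝ) - 1) := by
    rw [sub_pos, div_lt_one (by linarith)]; linarith
  -- This is 1 + x ≤ exp x at x = q/(n - 1 - q), after taking reciprocals. The total exponent (n -
  -- d)x tends to q(1 - ε) < r.
  have hbase : Real.exp (-(q / (n - 1 - q))) ≤ 1 - q / ((n : ℝ) - 1) := by
    have h1 : (1 - q / ((n : ℝ) - 1))⁻¹ = q / (n - 1 - q) + 1 := by
      have h2 : (n : ℝ) - 1 ≠ 0 := by linarith
      have h3 : (n : ℝ) - 1 - q ≠ 0 := by linarith
      rw [show 1 - q / ((n : ℝ) - 1) = (n - 1 - q) / (n - 1) by field_simp, inv_div]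
      field_simp
      ring
    have h2 := Real.add_one_le_exp (q / ((n : ℝ) - 1 - q))
    rw [← h1] at h2
    rw [Real.exp_neg]
    exact inv_le_of_inv_le₀ hx h2
  calc Real.exp (-r) ≤ Real.exp (-(q / (n - 1 - q))) ^ (n - deletedSize ε n) := by
        rw [← Real.exp_nat_mul, Real.exp_le_exp, Nat.cast_sub hdn]
        have e : q * (1 - (deletedSize ε n : ℝ) / n) / (1 - (1 + q) * (n : ℝ)⁻¹) =
            ((n : ℝ) - deletedSize ε n) * (q / (n - 1 - q)) := by
          have h3 : (n : ℝ) - 1 - q ≠ 0 := by linarith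
          rw [show (1 : ℝ) - (1 + q) * (n : ℝ)⁻¹ = (n - 1 - q) / n by field_simp; ring,
            show (1 : ℝ) - (deletedSize ε n : ℝ) / n = (n - deletedSize ε n) / n by field_simp]
          field_simp
        rw [e] at hn
        linarith
    _ ≤ _ := pow_le_pow_left₀ (Real.exp_pos _).le hbase _

/-- The runtime bound in terms of the lengths `α log n` and `β log n` of the initial and the final
phase. -/
theorem whpRuntimeAtLeast_slowGraph (P : Protocol) {ε : ℝ} (hε0 : 0 < ε) (hε1 : ε < 1)
    (q : unitInterval) (hq0 : 0 < (q : ℝ)) {α β r : ℝ} (hα : 0 ≤ α) (hβ : 0 ≤ β) (hr0 : 0 ≤ r)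
    (hαγ : α * Real.log (1 + q + pullFactor P * q) < 1) (hβr : β * r < 1)
    (hs : ∀ᶠ n : ℕ in atTop, ∀ t : ℕ, (t : ℝ) ≤ β * Real.log n → Real.exp (-(r * t)) ≤
      (ownCallHarmless P q * (1 - q / (n - 1)) ^ (n - deletedSize ε n) : ℝ) ^ t) :
    WhpRuntimeAtLeast P (slowGraph ε) q (α + β) := by
  have hpf : 0 ≤ pullFactor P := by cases P <;> simp [pullFactor]
  set γ₀ : ℝ := 1 + q + pullFactor P * q with hγ₀
  have hγ₀1 : 1 < γ₀ := by nlinarith [mul_nonneg hpf hq0.le]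
  set γ : ℕ → ℝ := fun n => 1 + q + pullFactor P * (q *
    ((sparseSize ε n : ℝ) / (n - deletedSize ε n) +
      (n - sparseSize ε n) / (n - sparseSize ε n - 1))) with hγ
  have hγlim : Tendsto γ atTop (𝓝 γ₀) := by
    have := (((tendsto_pull_rate hε0 hε1).const_mul (q : ℝ)).const_mul (pullFactor P)).const_add
      (1 + (q : ℝ))
    simpa [hγ₀] using this
  -- The room below 1 absorbs the convergence of `γ n` to `γ₀`: eventually (γ n)^t₁ ≤ n^θ, still
  -- negligible against the sparse block.
  obtain ⟨θ, hθ, hθ1⟩ := exists_between hαγ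
  have hθ0 : 0 ≤ θ := (mul_nonneg hα (Real.log_nonneg hγ₀1.le)).trans hθ.le
  have hlogγ : ∀ᶠ n in atTop, α * Real.log (γ n) < θ :=
    ((hγlim.log (by linarith)).const_mul α).eventually_lt_const hθ
  -- The two floors lose at most 2 rounds together. The error terms bound 4/(a s^t₂) and 2γ^t₁/a,
  -- where a is the size of the sparse block.
  refine whpRuntimeAtLeast_of_measureReal_le two_pos
    (fun n => ⌊α * Real.log n⌋₊ + ⌊β * Real.log n⌋₊)
    (fun n => 4 * ((sparseSize ε n : ℝ) / (n : ℝ) ^ (β * r))⁻¹ +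
      2 * ((sparseSize ε n : ℝ) / (n : ℝ) ^ θ)⁻¹) ?_ ?_ ?_
  · intro n
    have h1 := Nat.lt_floor_add_one (α * Real.log n)
    have h2 := Nat.lt_floor_add_one (β * Real.log n)
    push_cast
    linarith
  · have h1 := (tendsto_sparseSize_div_rpow hε0 (mul_nonneg hβ hr0) hβr).inv_tendsto_atTop
    have h2 := (tendsto_sparseSize_div_rpow hε0 hθ0 hθ1).inv_tendsto_atTop
    simpa using (h1.const_mul 4).add (h2.const_mul 2)
  have hpos := (tendsto_sparseSize_div_rpow hε0 le_rfl zero_lt_one).eventually_gt_atTop 0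
  have hsmall := (tendsto_sparseSize_div hε0).eventually_lt_const (by norm_num : (0 : ℝ) < 1 / 2)
  filter_upwards [hs, hlogγ, hγlim.eventually_const_lt hγ₀1, hpos, hsmall, eventually_ge_atTop 2]
    with n hsn hlogγn hγn hposn hsmalln hn2 v
  have hn1 : (2 : ℝ) ≤ n := by exact_mod_cast hn2
  have hlog0 : 0 ≤ Real.log n := Real.log_natCast_nonneg n
  have ha0 : 0 < sparseSize ε n := by
    rw [Real.rpow_zero, div_one] at hposn
    exact_mod_cast hposn
  have hd := deletedSize_lt hε0 hε1 (by omega : 1 ≤ n)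
  have had := sparseSize_le_deletedSize hε0 (by omega : 1 ≤ n)
  have ha : sparseSize ε n + 1 < n := by
    rw [div_lt_iff₀ (by linarith)] at hsmalln
    have ha0' : (1 : ℝ) ≤ sparseSize ε n := by exact_mod_cast ha0
    have : (sparseSize ε n : ℝ) + 1 < n := by linarith
    exact_mod_cast this
  set t₁ := ⌊α * Real.log n⌋₊ with ht₁
  set t₂ := ⌊β * Real.log n⌋₊ with ht₂
  have ht₁le : (t₁ : ℝ) ≤ α * Real.log n := Nat.floor_le (mul_nonneg hα hlog0)
  have ht₂le : (t₂ : ℝ) ≤ β * Real.log n := Nat.floor_le (mul_nonneg hβ hlog0)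
  have hst := hsn t₂ ht₂le
  set s : ℝ := ownCallHarmless P q * (1 - q / (n - 1)) ^ (n - deletedSize ε n) with hs_def
  have hspos : 0 < s ^ t₂ := (Real.exp_pos _).trans_le hst
  have hapos : (0 : ℝ) < sparseSize ε n := by exact_mod_cast ha0
  have key := measureReal_informed_threeBlockGraph_le q P ha0 had hd ha (le_refl (γ n)) v t₁ t₂
    hspos
  refine key.trans (add_le_add ?_ ?_)
  · have hslow : ((n : ℝ) ^ (β * r))⁻¹ ≤ s ^ t₂ := by
      refine le_trans ?_ hst
      rw [← Real.rpow_neg (by linarith), Real.rpow_def_of_pos (by linarith), Real.exp_le_exp]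
      nlinarith
    have hrp : 0 < (n : ℝ) ^ (β * r) := Real.rpow_pos_of_pos (by linarith) _
    rw [inv_div, mul_div_assoc', div_le_div_iff₀ (by positivity) hapos]
    have h1 : 1 ≤ (n : ℝ) ^ (β * r) * s ^ t₂ := by
      rw [inv_eq_one_div, div_le_iff₀ hrp] at hslow
      linarith
    nlinarith
  · have hγpow : γ n ^ t₁ ≤ (n : ℝ) ^ θ := by
      rw [← Real.rpow_natCast, Real.rpow_def_of_pos (by linarith),
        Real.rpow_def_of_pos (by linarith), Real.exp_le_exp]
      have hl := Real.log_nonneg hγn.le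
      calc Real.log (γ n) * t₁ ≤ Real.log (γ n) * (α * Real.log n) :=
            mul_le_mul_of_nonneg_left ht₁le hl
        _ = α * Real.log (γ n) * Real.log n := by ring
        _ ≤ θ * Real.log n := mul_le_mul_of_nonneg_right hlogγn.le hlog0
        _ = Real.log n * θ := mul_comm _ _
    rw [inv_div, mul_div_assoc']
    exact div_le_div_of_nonneg_right (by linarith) hapos.le

theorem whpRuntimeAtLeast_slowGraph_of_lt (P : Protocol) {ε : ℝ} (hε0 : 0 < ε) (hε1 : ε < 1)
    (q : unitInterval) (hq0 : 0 < (q : ℝ)) (hown : 0 < ownCallHarmless P q) {c : ℝ}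
    (hc : c < 1 / Real.log (1 + q + pullFactor P * q) +
      1 / (q * (1 - ε) - Real.log (ownCallHarmless P q))) :
    WhpRuntimeAtLeast P (slowGraph ε) q c := by
  have hq1 : (q : ℝ) ≤ 1 := q.2.2
  have hpf : 0 ≤ pullFactor P := by cases P <;> simp [pullFactor]
  have hown1 : ownCallHarmless P q ≤ 1 := by cases P <;> simp [ownCallHarmless, hq0.le]
  have hγ : 0 < Real.log (1 + q + pullFactor P * q) :=
    Real.log_pos (by nlinarith [mul_nonneg hpf hq0.le])
  set r₀ : ℝ := q * (1 - ε) - Real.log (ownCallHarmless P q) with hr₀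
  have hr₀pos : 0 < r₀ := by
    have h1 := Real.log_nonpos hown.le hown1
    have h2 : 0 < (q : ℝ) * (1 - ε) := mul_pos hq0 (by linarith)
    linarith
  set x := 1 / Real.log (1 + q + pullFactor P * q) with hx
  set y := 1 / r₀ with hy
  have hx0 : 0 < x := by positivity
  have hy0 : 0 < y := by positivity
  -- The slack is shared equally, since (x - δ) + (y - δ) = c. The maxima below keep `α` nonnegative
  -- and `β` positive, so that 1/β makes sense.
  set δ := (x + y - c) / 2 with hδ
  have hδ0 : 0 < δ := by rw [hδ]; linarith
  set α := max (x - δ) 0 with hα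
  set β := max (y - δ) (y / 2) with hβ
  have hαx : α < x := max_lt (by linarith) hx0
  have hβy : β < y := max_lt (by linarith) (by linarith)
  have hβ0 : 0 < β := lt_of_lt_of_le (by linarith) (le_max_right _ _)
  have hβr₀ : β * r₀ < 1 := by rwa [hy, lt_div_iff₀ hr₀pos] at hβy
  -- Any `r` strictly between r₀ and 1/β works: r₀ < r yields the bound per round for large n, and r
  -- < 1/β yields β r < 1.
  set r := (r₀ + 1 / β) / 2 with hr
  have hβinv : β * (1 / β) = 1 := by field_simp
  have hr₀r : r₀ < r := by
    have : r₀ < 1 / β := by rw [lt_div_iff₀ hβ0]; linarith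
    rw [hr]; linarith
  refine (whpRuntimeAtLeast_slowGraph P hε0 hε1 q hq0 (α := α) (β := β) (r := r)
    (le_max_right _ _) hβ0.le (by linarith) ?_ ?_ ?_).mono ?_
  · rwa [hx, lt_div_iff₀ hγ] at hαx
  · have : β * r = (β * r₀ + β * (1 / β)) / 2 := by rw [hr]; ring
    rw [this, hβinv]; linarith
  · have hr' : (q : ℝ) * (1 - ε) < r + Real.log (ownCallHarmless P q) := by linarith
    filter_upwards [eventually_exp_neg_le_pow hε0 hε1 hq0 hr'] with n hn t _
    have h1 : Real.exp (-r) ≤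
        ownCallHarmless P q * (1 - q / (n - 1)) ^ (n - deletedSize ε n) := by
      have h2 := mul_le_mul_of_nonneg_left hn hown.le
      refine le_trans (le_of_eq ?_) h2
      rw [neg_add, Real.exp_add, Real.exp_neg (Real.log _), Real.exp_log hown]
      field_simp
    calc Real.exp (-(r * t)) = Real.exp (-r) ^ t := by
          rw [← Real.exp_nat_mul]; ring_nf
      _ ≤ _ := pow_le_pow_left₀ (Real.exp_pos _).le h1 t
  · have h1 : x - δ ≤ α := le_max_left _ _
    have h2 : y - δ ≤ β := le_max_left _ _
    linarith

/-- The growth phase alone, with β = 0. It covers push&pull at q = 1, where `ownCallHarmless`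
vanishes and no second phase is available. -/
theorem whpRuntimeAtLeast_slowGraph_of_lt_growth (P : Protocol) {ε : ℝ} (hε0 : 0 < ε)
    (hε1 : ε < 1) (q : unitInterval) (hq0 : 0 < (q : ℝ)) {c : ℝ}
    (hc : c < 1 / Real.log (1 + q + pullFactor P * q)) :
    WhpRuntimeAtLeast P (slowGraph ε) q c := by
  have hpf : 0 ≤ pullFactor P := by cases P <;> simp [pullFactor]
  have hγ : 0 < Real.log (1 + q + pullFactor P * q) :=
    Real.log_pos (by nlinarith [mul_nonneg hpf hq0.le])
  refine (whpRuntimeAtLeast_slowGraph P hε0 hε1 q hq0 (α := max c 0) (β := 0) (r := 0)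
    (le_max_right _ _) le_rfl le_rfl ?_ (by simp) ?_).mono (by simp)
  · have : max c 0 < 1 / Real.log (1 + q + pullFactor P * q) := max_lt hc (by positivity)
    rwa [lt_div_iff₀ hγ] at this
  -- With β = 0 only t = 0 is admissible, and both sides equal 1 even if the base is 0.
  · refine Eventually.of_forall fun n t ht => ?_
    have : t = 0 := by
      rw [zero_mul] at ht
      exact_mod_cast le_antisymm ht (Nat.cast_nonneg t)
    simp [this]

theorem whpRuntimeAtLeast_push_slowGraph {ε q : ℝ} (hε0 : 0 < ε) (hε1 : ε < 1) (hq0 : 0 < q)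
    (hq1 : q ≤ 1) :
    WhpRuntimeAtLeast .push (slowGraph ε) ⟨q, hq0.le, hq1⟩ (cPush q + ε / (2 * q)) := by
  refine whpRuntimeAtLeast_slowGraph_of_lt .push hε0 hε1 _ hq0 one_pos ?_
  simpa [pullFactor, ownCallHarmless] using push_constant_lt hε0 hε1 hq0

theorem whpRuntimeAtLeast_pushPull_slowGraph {ε q : ℝ} (hε0 : 0 < ε) (hε1 : ε < 1) (hq0 : 0 < q)
    (hq1 : q ≤ 1) :
    WhpRuntimeAtLeast .pushPull (slowGraph ε) ⟨q, hq0.le, hq1⟩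
      (cPP q + (ε / (8 * q) - ε * q ^ 3 / 5)) := by
  have e : 1 + q + pullFactor .pushPull * q = 1 + 2 * q := by rw [pullFactor]; ring
  rcases hq1.lt_or_eq with h | rfl
  · refine whpRuntimeAtLeast_slowGraph_of_lt .pushPull hε0 hε1 _ hq0 (sub_pos.2 h) ?_
    change _ < 1 / Real.log (1 + q + pullFactor .pushPull * q) + _
    rw [e]
    exact pushPull_constant_lt hε0 hε1 hq0 h
  -- At q = 1 the extra term ε/8 - ε/5 is negative, so the target lies strictly below 1/log 3.
  · refine whpRuntimeAtLeast_slowGraph_of_lt_growth .pushPull hε0 hε1 _ hq0 ?_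
    change _ < 1 / Real.log (1 + 1 + pullFactor .pushPull * 1)
    rw [e, cPP, if_pos rfl]
    norm_num
    linarith

end RumourSpreading

open RumourSpreading
theorem mainTheorem3 (ε : ℝ) (hε : 0 < ε) (q : ℝ) (hq0 : 0 < q) (hq1 : q ≤ 1) :
    ∃ G G' : (n : ℕ) → SimpleGraph (Fin n),
      IsExpanderSequence G ∧
      (∀ n, IsDeletionKeeping (1 - ε) (G n) (G' n)) ∧
      (∀ n, 1 ≤ n → (G' n).Connected) ∧
      WhpRuntimeAtLeast .push G' ⟨q, hq0.le, hq1⟩ (cPush q + ε / (2 * q)) ∧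
      WhpRuntimeAtLeast .pushPull G' ⟨q, hq0.le, hq1⟩
        (cPP q + (ε / (8 * q) - ε * q ^ 3 / 5)) := by
  rcases lt_or_ge ε 1 with hε1 | hε1
  · refine ⟨fun _ => ⊤, slowGraph ε, isExpanderSequence_top, fun n => ?_, fun n hn =>
      threeBlockGraph_connected (deletedSize_lt hε hε1 hn),
      whpRuntimeAtLeast_push_slowGraph hε hε1 hq0 hq1,
      whpRuntimeAtLeast_pushPull_slowGraph hε hε1 hq0 hq1⟩
    rcases Nat.eq_zero_or_pos n with rfl | hn
    · exact ⟨le_top, fun v => v.elim0⟩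
    · exact isDeletionKeeping_threeBlockGraph (sparseSize_le_deletedSize hε hn)
        (deletedSize_lt hε hε1 hn) (deletedSize_le hε hn)
  -- Here 1 - ε ≤ 0, so the degree condition is vacuous and the complete graph may be thinned to a
  -- path.
  · refine ⟨fun _ => ⊤, SimpleGraph.pathGraph, isExpanderSequence_top,
      fun n => ⟨le_top, fun v => ?_⟩, fun n hn => connected_pathGraph_of_one_le hn,
      whpRuntimeAtLeast_pathGraph _ _ _,
      whpRuntimeAtLeast_pathGraph _ _ _⟩
    exact (mul_nonpos_of_nonpos_of_nonneg (by linarith) (Nat.cast_nonneg _)).trans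
      (Nat.cast_nonneg _)
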